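/- Let $M$ be a Hausdorff smooth manifold, let $\mathbb F\in\{\mathbb R,\mathbb C\}$, and let $R=C_c^\infty(M)$ be the ring (in general without identity) of smooth $\mathbb F$-valued functions with compact support on $M$. Let $C$ be a coalgebra over $R$, i.e. an $R$-module in which any finitely many elements $c_1,\dots,c_k$ admit $r\in R$ with $rc_i=c_i$ for all $i$, together with $R$-linear maps $\Delta:C\to C\otimes_R C$ and $\epsilon:C\to R$ such that $(\mathrm{id}\otimes\epsilon)\circ\Delta=\mathrm{id}=(\epsilon\otimes\mathrm{id})\circ\Delta$. An element $c\in C$ is weakly grouplike if $\Delta(c)=c\otimes c'$ for some $c'\in C$; the set of these elements is $G_w(C)$. An element $c\in C$ is normalized at $x\in M$ if the germ $\epsilon(c)_x$ equals $1$, and normalized on $W\subset M$ if it is normalized at every point of $W$. For $x\in M$ put $N_x(C)=\{c\in C\mid fc=0\text{ for some }f\in R\text{ with germ }f_x=1\}$ and $C_x=C/N_x(C)$, and write $c_x$ for the class of $c$ in $C_x$. The maps $\Delta$ and $\epsilon$ induce a coalgebra structure $(\Delta_x,\epsilon_x)$ on $C_x$ over the ring $R_x$ of germs at $x$ of smooth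 functions, and $G(C_x)=\{\zeta\in C_x\mid\Delta_x(\zeta)=\zeta\otimes\zeta,\ \epsilon_x(\zeta)=1\}$. The spectral sheaf $\pi:\mathcal E_{sp}(C)\to M$ is the sheaf with stalks $\mathcal E_{sp}(C)_x=G(C_x)$; its topology has as basis the sets $c_W=\{c_x\mid x\in W\}$, where $W\subset M$ is open and $c\in G_w(C)$ is normalized on $W$, and its (not necessarily Hausdorff) smooth structure is the one for which $\pi$ is a local diffeomorphism. For a not necessarily Hausdorff manifold $E$, $C_c^\infty(E)$ denotes the group of finite sums of extensions by zero of smooth functions with compact support on Hausdorff open subsets of $E$, as not necessarily continuous sections of the sheaf of germs of functions on $E$. Let $\Psi_C:C_c^\infty(\mathcal E_{sp}(C))\to C$ be the well-defined map given by $$\Psi_C\Big(\sum_{i=1}^k f_i\circ\pi|_{(c_i)_{W_i}}\Big)=\sum_{i=1}^k f_ic_i ,$$ where $c_i\in G_w(C)$ is normalized on the open set $W_i\subset M$ and $f_i\in C_c^\infty(W_i)$. Let $\Lambda\subset G_w(C)$. Let $\mathcal E_{sp}^\Lambda(C)\subset\mathcal E_{sp}(C)$ be the open subsheaf with stalks $\{c_x\mid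 c\in\Lambda,\ \epsilon(c)_x=1\}$, let $\mathrm{inc}_+:C_c^\infty(\mathcal E_{sp}^\Lambda(C))\to C_c^\infty(\mathcal E_{sp}(C))$ be extension by zero, and let $\Psi_C^\Lambda=\Psi_C\circ\mathrm{inc}_+$. Then: (i) $\Psi_C^\Lambda$ is surjective if and only if $\Lambda$ normally generates $C$, i.e. every $c\in C$ is a finite sum $c=\sum_{i=1}^k f_ic_i$ with $f_i\in R$ and $c_i\in\Lambda$ normalized on $\mathrm{supp}(f_i)$. (ii) $\Psi_C^\Lambda$ is injective if and only if $\Lambda$ is normally linearly independent, i.e. for every $x\in M$, all $c_1,\dots,c_k\in\Lambda$ normalized at $x$ and all $f_1,\dots,f_k\in R$ with $\sum_{i=1}^k f_ic_i=0$, either $(f_i)_x=0$ for all $i$, or there are distinct indices $i,j$ and $f\in R$ with $f_x=1$ and $fc_i=fc_j$. -/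

import Mathlib

open scoped Manifold ContDiff Topology TensorProduct
open Filter

noncomputable section

namespace SheafCoalg

/-! ### Modules and coalgebras over a commutative ring without identity -/

/-- A (left) module over a commutative ring `R` which need not have an identity. -/
class NUModule (R : Type*) [NonUnitalCommRing R] (C : Type*) [AddCommGroup C]
    extends SMul R C where
  smul_add' : ∀ (r : R) (c d : C), r • (c + d) = r • c + r • d
  add_smul' : ∀ (r s : R) (c : C), (r + s) • c = r • c + s • c
  mul_smul' : ∀ (r s : R) (c : C), (r * s) • c = r • (s • c)

/-- The ring `R` with an identity freely adjoined.  Modules over the non-unital ring `R` are the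
same as unital modules over `Plus R`, with the same submodules, quotients, linear maps and tensor
products (the integers act on any abelian group, and additive maps and tensors are automatically
linear, respectively balanced, over them). -/
def Plus (R : Type*) [NonUnitalCommRing R] : Type _ := Unitization ℤ R

instance plusCommRing (R : Type*) [NonUnitalCommRing R] : CommRing (Plus R) :=
  inferInstanceAs (CommRing (Unitization ℤ R))

/-- The inclusion of `R` into `Plus R`. -/
def ofR {R : Type*} [NonUnitalCommRing R] (r : R) : Plus R := (Unitization.inr r : Unitization ℤ R)

theorem ofR_mul {R : Type*} [NonUnitalCommRing R] (r s : R) : ofR (r * s) = ofR r * ofR s :=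
  Unitization.inr_mul ℤ r s

section Algebra

variable {R : Type*} [NonUnitalCommRing R] {C : Type*} [AddCommGroup C] [NUModule R C]

theorem nu_smul_zero (r : R) : r • (0 : C) = 0 := by
  have h := NUModule.smul_add' r (0 : C) 0
  simpa using h

theorem nu_zero_smul (c : C) : (0 : R) • c = 0 := by
  have h := NUModule.add_smul' (0 : R) 0 c
  simpa using h

/-- The action of `R` on a module, as a biadditive map. -/
def actHom (R : Type*) [NonUnitalCommRing R] (C : Type*) [AddCommGroup C] [NUModule R C] :
    R →+ C →+ C where
  toFun r :=
    { toFun := fun c => r • c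
      map_zero' := nu_smul_zero r
      map_add' := NUModule.smul_add' r }
  map_zero' := by ext c; exact nu_zero_smul c
  map_add' r s := by ext c; exact NUModule.add_smul' r s c

theorem nu_smul_zsmul (r : R) (k : ℤ) (c : C) : r • (k • c) = k • (r • c) :=
  map_zsmul (actHom R C r) k c

theorem nu_zsmul_smul (r : R) (k : ℤ) (c : C) : (k • r) • c = k • (r • c) := by
  have := congrArg (fun φ : C →+ C => φ c) (map_zsmul (actHom R C) k r)
  simpa [actHom] using this

/-- A module over the non-unital ring `R` is a unital module over `Plus R`:
`(k + r) c = k c + r c` for an integer `k` and `r` in `R`. -/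
instance plusModule : Module (Plus R) C where
  smul a c := (Unitization.toProd a).1 • c + (Unitization.toProd a).2 • c
  one_smul c := by
    change (1 : ℤ) • c + (0 : R) • c = c
    rw [nu_zero_smul]; simp
  mul_smul a b c := by
    change ((Unitization.toProd a).1 * (Unitization.toProd b).1) • c + ((Unitization.toProd a).1 • (Unitization.toProd b).2 + (Unitization.toProd b).1 • (Unitization.toProd a).2 + (Unitization.toProd a).2 * (Unitization.toProd b).2) • c
      = (Unitization.toProd a).1 • ((Unitization.toProd b).1 • c + (Unitization.toProd b).2 • c) + (Unitization.toProd a).2 • ((Unitization.toProd b).1 • c + (Unitization.toProd b).2 • c)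
    simp only [NUModule.add_smul', NUModule.mul_smul', NUModule.smul_add', nu_smul_zsmul,
      nu_zsmul_smul, mul_smul, smul_add]
    abel
  smul_zero a := by
    change (Unitization.toProd a).1 • (0 : C) + (Unitization.toProd a).2 • (0 : C) = 0
    rw [nu_smul_zero]; simp
  smul_add a c d := by
    change (Unitization.toProd a).1 • (c + d) + (Unitization.toProd a).2 • (c + d) = ((Unitization.toProd a).1 • c + (Unitization.toProd a).2 • c) + ((Unitization.toProd a).1 • d + (Unitization.toProd a).2 • d)
    rw [NUModule.smul_add', smul_add]; abel
  add_smul a b c := by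
    change ((Unitization.toProd a).1 + (Unitization.toProd b).1) • c + ((Unitization.toProd a).2 + (Unitization.toProd b).2) • c
      = ((Unitization.toProd a).1 • c + (Unitization.toProd a).2 • c) + ((Unitization.toProd b).1 • c + (Unitization.toProd b).2 • c)
    rw [NUModule.add_smul', add_smul]; abel
  zero_smul c := by
    change (0 : ℤ) • c + (0 : R) • c = 0
    rw [nu_zero_smul]; simp

theorem plus_smul_def (a : Plus R) (c : C) :
    a • c = (Unitization.toProd a).1 • c + (Unitization.toProd a).2 • c := rfl

theorem ofR_smul (r : R) (c : C) : ofR r • c = r • c := by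
  rw [plus_smul_def]
  change (0 : ℤ) • c + r • c = r • c
  simp

/-- The ring `R` as a module over itself. -/
instance selfModule (R : Type*) [NonUnitalCommRing R] : NUModule R R where
  smul r s := r * s
  smul_add' := mul_add
  add_smul' := add_mul
  mul_smul' := mul_assoc

/-- The action `R × C → C` as a bilinear map; it induces the natural identification of
`R ⊗ C` with `C`, if `C` is locally unitary. -/
def act (R : Type*) [NonUnitalCommRing R] (C : Type*) [AddCommGroup C] [NUModule R C] :
    R →ₗ[Plus R] C →ₗ[Plus R] C :=
  LinearMap.mk₂ (Plus R) (fun r c => r • c)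
    (fun r s c => NUModule.add_smul' r s c)
    (fun a r c => by
      rw [plus_smul_def, plus_smul_def, NUModule.add_smul', nu_zsmul_smul]
      congr 1
      exact NUModule.mul_smul' ((Unitization.toProd a).2) r c)
    (fun r c d => NUModule.smul_add' r c d)
    (fun a r c => by
      rw [plus_smul_def, plus_smul_def, NUModule.smul_add', nu_smul_zsmul, ← NUModule.mul_smul',
        ← NUModule.mul_smul', mul_comm])

end Algebra

/-- A coalgebra over the commutative ring `R`: a locally unitary `R`-module `C` with `R`-linear maps
`Δ : C → C ⊗ C` and `ε : C → R` such that `(ε ⊗ id) ∘ Δ = id` and `(id ⊗ ε) ∘ Δ = id`.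
Neither coassociativity nor cocommutativity is required. -/
class Coalg (R : Type*) [NonUnitalCommRing R] (C : Type*) [AddCommGroup C] [NUModule R C] where
  locallyUnitary : ∀ s : Finset C, ∃ r : R, ∀ c ∈ s, r • c = c
  comul : C →ₗ[Plus R] C ⊗[Plus R] C
  counit : C →ₗ[Plus R] R
  counit_comul : ∀ c : C, TensorProduct.lift (act R C ∘ₗ counit) (comul c) = c
  comul_counit : ∀ c : C, TensorProduct.lift (act R C ∘ₗ counit).flip (comul c) = c

/-- The weakly grouplike elements: `Δ c = c ⊗ c'` for some `c'`. -/
def weaklyGrouplike (R : Type*) [NonUnitalCommRing R] (C : Type*) [AddCommGroup C] [NUModule R C]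
    [Coalg R C] : Set C :=
  {c | ∃ c' : C, Coalg.comul (R := R) c = c ⊗ₜ[Plus R] c'}

/-! ### Smooth functions with compact support on a Hausdorff manifold -/

/-- `Cc 𝔽 n N` is the ring of smooth `𝔽`-valued functions with compact support on the
(Hausdorff) manifold `N` of dimension `n`. -/
def Cc (𝔽 : Type*) [RCLike 𝔽] (n : ℕ) (N : Type*) [TopologicalSpace N]
    [ChartedSpace (EuclideanSpace ℝ (Fin n)) N] : NonUnitalSubring (N → 𝔽) where
  carrier := {f | ContMDiff (𝓡 n) 𝓘(ℝ, 𝔽) ∞ f ∧ HasCompactSupport f}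
  zero_mem' := ⟨contMDiff_const, HasCompactSupport.zero⟩
  add_mem' hf hg := ⟨hf.1.add hg.1, hf.2.add hg.2⟩
  neg_mem' hf := ⟨hf.1.neg, hf.2.neg⟩
  mul_mem' hf hg := ⟨by
    intro x
    have := (contDiff_mul (𝕜 := ℝ) (𝔸 := 𝔽) (n := ∞)).contMDiff.contMDiffAt.comp x
      ((hf.1 x).prodMk_space (hg.1 x))
    exact this, hf.2.mul_right⟩

section Bump

variable {𝔽 : Type*} [RCLike 𝔽] {n : ℕ} {N : Type*} [TopologicalSpace N]
  [ChartedSpace (EuclideanSpace ℝ (Fin n)) N]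

theorem Cc.add_apply (f g : Cc 𝔽 n N) (x : N) : (f + g : Cc 𝔽 n N).1 x = f.1 x + g.1 x := rfl

theorem Cc.mul_apply (f g : Cc 𝔽 n N) (x : N) : (f * g : Cc 𝔽 n N).1 x = f.1 x * g.1 x := rfl

/-- Bump functions. -/
theorem exists_bump [IsManifold (𝓡 n) ∞ N] [T2Space N] {x : N} {U : Set N} (hU : U ∈ 𝓝 x) :
    ∃ f : Cc 𝔽 n N, f.1 =ᶠ[𝓝 x] 1 ∧ tsupport f.1 ⊆ U := by
  obtain ⟨b, -, hb⟩ := (SmoothBumpFunction.nhds_basis_tsupport (I := 𝓡 n) x).mem_iff.1 hU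
  have hsub : tsupport (fun y => ((b y : ℝ) : 𝔽)) ⊆ tsupport b :=
    closure_mono fun y hy => by
      intro h0
      exact hy (by simp [h0])
  refine ⟨⟨fun y => ((b y : ℝ) : 𝔽), ?_, ?_⟩, ?_, hsub.trans hb⟩
  · have h : ContMDiff 𝓘(ℝ, ℝ) 𝓘(ℝ, 𝔽) ∞ (fun r : ℝ => (r : 𝔽)) :=
      (RCLike.ofRealCLM (K := 𝔽)).contDiff.contMDiff
    exact h.comp b.contMDiff
  · exact b.hasCompactSupport.of_isClosed_subset (isClosed_tsupport _) hsub
  · filter_upwards [b.eventuallyEq_one] with y hy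
    simp [hy]

/-- A property of smooth functions with compact support which is additive and holds for functions
supported near any given point holds for all of them. -/
theorem Cc.induction [IsManifold (𝓡 n) ∞ N] [T2Space N] (P : Cc 𝔽 n N → Prop)
    (h0 : P 0) (hadd : ∀ f g, P f → P g → P (f + g))
    (hloc : ∀ x : N, ∃ V ∈ 𝓝 x, ∀ f, tsupport f.1 ⊆ V → P f) (f : Cc 𝔽 n N) : P f := by
  have key : ∃ b : Cc 𝔽 n N, (∃ V ∈ 𝓝ˢ (tsupport f.1), ∀ y ∈ V, b.1 y = 1) ∧ ∀ g, P (b * g) := by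
    have hK : IsCompact (tsupport f.1) := f.2.2
    generalize tsupport f.1 = K at hK
    refine hK.induction_on (p := fun K => ∃ b : Cc 𝔽 n N,
      (∃ V ∈ 𝓝ˢ K, ∀ y ∈ V, b.1 y = 1) ∧ ∀ g, P (b * g)) ?_ ?_ ?_ ?_
    · exact ⟨0, ⟨∅, by simp, by simp⟩, fun g => by simpa using h0⟩
    · rintro s t hst ⟨b, ⟨V, hV, h1⟩, h2⟩
      exact ⟨b, ⟨V, nhdsSet_mono hst hV, h1⟩, h2⟩
    · rintro s t ⟨b, ⟨V, hV, h1⟩, h2⟩ ⟨b', ⟨V', hV', h1'⟩, h2'⟩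
      refine ⟨b + b' - b' * b, ⟨V ∪ V', ?_, ?_⟩, fun g => ?_⟩
      · rw [nhdsSet_union]
        exact ⟨mem_of_superset hV Set.subset_union_left,
          mem_of_superset hV' Set.subset_union_right⟩
      · intro y hy
        change b.1 y + b'.1 y - b'.1 y * b.1 y = 1
        rcases hy with hy | hy
        · rw [h1 y hy]; ring
        · rw [h1' y hy]; ring
      · have : (b + b' - b' * b) * g = b * g + b' * (g - b * g) := by
          simp only [mul_sub, sub_mul, add_mul, mul_assoc]; abel
        rw [this]
        exact hadd _ _ (h2 g) (h2' _)
    · intro x _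
      obtain ⟨V, hV, hP⟩ := hloc x
      obtain ⟨b, hb1, hb2⟩ := exists_bump (𝔽 := 𝔽) (n := n) hV
      obtain ⟨W, hW, hWo, hxW⟩ := mem_nhds_iff.1 hb1
      refine ⟨W, mem_nhdsWithin_of_mem_nhds (hWo.mem_nhds hxW), b,
        ⟨W, hWo.mem_nhdsSet.2 subset_rfl, fun y hy => hW hy⟩, fun g => hP _ ?_⟩
      exact (tsupport_mul_subset_left (f := b.1) (g := g.1)).trans hb2
  obtain ⟨b, ⟨V, hV, h1⟩, h2⟩ := key
  have : b * f = f := by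
    ext y
    change b.1 y * f.1 y = f.1 y
    by_cases hy : y ∈ tsupport f.1
    · rw [h1 y (subset_of_mem_nhdsSet hV hy), one_mul]
    · rw [image_eq_zero_of_notMem_tsupport hy, mul_zero]
  rw [← this]
  exact h2 f

end Bump

/-! ### Sheaves: the smooth structure on the total space of a local homeomorphism -/

section LocalHomeo

variable {n : ℕ} {M : Type*} [TopologicalSpace M] [ChartedSpace (EuclideanSpace ℝ (Fin n)) M]
  {E : Type*} [TopologicalSpace E] {p : E → M}

/-- A local inverse datum of the local homeomorphism `p` near the point `y`. -/
def localHomeo (hp : IsLocalHomeomorph p) (y : E) : OpenPartialHomeomorph E M := (hp y).choose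

theorem mem_localHomeo (hp : IsLocalHomeomorph p) (y : E) : y ∈ (localHomeo hp y).source :=
  (hp y).choose_spec.1

theorem localHomeo_eq (hp : IsLocalHomeomorph p) (y : E) : ⇑(localHomeo hp y) = p :=
  (hp y).choose_spec.2.symm

/-- The total space of a local homeomorphism `p` over a manifold: the charts are the restrictions
of `p` to open sets on which it is injective, followed by charts of the base. -/
@[reducible] def etaleChartedSpace (n : ℕ) [ChartedSpace (EuclideanSpace ℝ (Fin n)) M]
    (hp : IsLocalHomeomorph p) :
    ChartedSpace (EuclideanSpace ℝ (Fin n)) E where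
  atlas := {e | ∃ y : E, e = (localHomeo hp y).trans
    (chartAt (EuclideanSpace ℝ (Fin n)) (p y))}
  chartAt y := (localHomeo hp y).trans (chartAt (EuclideanSpace ℝ (Fin n)) (p y))
  mem_chart_source y := by
    rw [OpenPartialHomeomorph.trans_source]
    refine ⟨mem_localHomeo hp y, ?_⟩
    rw [Set.mem_preimage, localHomeo_eq]
    exact mem_chart_source _ _
  chart_mem_atlas y := ⟨y, rfl⟩

theorem etale_isManifold (hp : IsLocalHomeomorph p) [IsManifold (𝓡 n) ∞ M] :
    let _ := etaleChartedSpace n hp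
    IsManifold (𝓡 n) ∞ E := by
  let _ := etaleChartedSpace n hp
  have : HasGroupoid E (contDiffGroupoid ∞ (𝓡 n)) := by
    refine ⟨?_⟩
    rintro _ _ ⟨y, rfl⟩ ⟨z, rfl⟩
    set e := localHomeo hp y with he
    set e' := localHomeo hp z with he'
    set a := chartAt (EuclideanSpace ℝ (Fin n)) (p y)
    set b := chartAt (EuclideanSpace ℝ (Fin n)) (p z)
    have hab : a.symm.trans b ∈ contDiffGroupoid ∞ (𝓡 n) :=
      (contDiffGroupoid ∞ (𝓡 n)).compatible (chart_mem_atlas _ _) (chart_mem_atlas _ _)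
    have hs : IsOpen ((e.trans a).symm.trans (e'.trans b)).source :=
      OpenPartialHomeomorph.open_source _
    refine (contDiffGroupoid ∞ (𝓡 n)).mem_of_eqOnSource
      (closedUnderRestriction' hab hs) ?_
    constructor
    · rw [OpenPartialHomeomorph.restr_source' _ _ hs]
      refine (Set.inter_eq_right.2 ?_).symm
      intro t ht
      simp only [OpenPartialHomeomorph.trans_source, OpenPartialHomeomorph.symm_source,
        Set.mem_inter_iff, Set.mem_preimage, OpenPartialHomeomorph.coe_trans_symm,
        OpenPartialHomeomorph.trans_target, Function.comp_apply] at ht ⊢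
      have h1 : e' (e.symm (a.symm t)) = a.symm t := by
        rw [localHomeo_eq, ← localHomeo_eq hp y]
        exact e.right_inv ht.1.2
      exact ⟨ht.1.1, by simpa [h1] using ht.2.2⟩
    · intro t ht
      simp only [OpenPartialHomeomorph.trans_source, OpenPartialHomeomorph.symm_source,
        Set.mem_inter_iff, Set.mem_preimage, OpenPartialHomeomorph.coe_trans_symm,
        OpenPartialHomeomorph.trans_target, Function.comp_apply] at ht
      have h1 : e' (e.symm (a.symm t)) = a.symm t := by
        rw [localHomeo_eq, ← localHomeo_eq hp y]
        exact e.right_inv ht.1.2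
      simp [h1]
  exact IsManifold.mk' _ _ _

/-- A function on the total space is smooth near `y` iff it is the pull-back of a smooth function
on the base near `y`. -/
theorem etale_contMDiffAt_iff {𝔽 : Type*} [RCLike 𝔽] (hp : IsLocalHomeomorph p) {g : E → 𝔽}
    {y : E} :
    let _ := etaleChartedSpace n hp
    ContMDiffAt (𝓡 n) 𝓘(ℝ, 𝔽) ∞ g y ↔
      ∃ k : M → 𝔽, ContMDiffAt (𝓡 n) 𝓘(ℝ, 𝔽) ∞ k (p y) ∧ g =ᶠ[𝓝 y] k ∘ p := by
  let _ := etaleChartedSpace n hp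
  set e := localHomeo hp y with he
  have hey : y ∈ e.source := mem_localHomeo hp y
  have hep : ⇑e = p := localHomeo_eq hp y
  have main : ContMDiffAt (𝓡 n) 𝓘(ℝ, 𝔽) ∞ g y ↔
      ContMDiffAt (𝓡 n) 𝓘(ℝ, 𝔽) ∞ (g ∘ e.symm) (p y) := by
    rw [contMDiffAt_iff, contMDiffAt_iff]
    have h1 : ContinuousAt g y ↔ ContinuousAt (g ∘ e.symm) (p y) := by
      rw [← hep]
      constructor
      · intro h
        refine ContinuousAt.comp ?_ (e.continuousAt_symm (e.map_source hey))
        rwa [e.left_inv hey]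
      · intro h
        refine (h.comp (e.continuousAt hey)).congr ?_
        filter_upwards [e.open_source.mem_nhds hey] with z hz
        rw [Function.comp_apply, Function.comp_apply, e.left_inv hz]
    rw [h1]
    refine and_congr Iff.rfl ?_
    have h2 : extChartAt (𝓡 n) y y = extChartAt (𝓡 n) (p y) (p y) := by
      simp only [extChartAt, OpenPartialHomeomorph.extend_coe, Function.comp_apply]
      change (𝓡 n) ((e.trans (chartAt _ (p y))) y) = _
      rw [OpenPartialHomeomorph.coe_trans, Function.comp_apply, hep]
    rw [h2]
    exact Iff.rfl
  refine main.trans ?_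
  constructor
  · intro h
    refine ⟨_, h, ?_⟩
    filter_upwards [e.open_source.mem_nhds hey] with z hz
    rw [Function.comp_apply, Function.comp_apply, ← hep, e.left_inv hz]
  · rintro ⟨k, hk, hgk⟩
    refine hk.congr_of_eventuallyEq ?_
    have ht : Tendsto e.symm (𝓝 (p y)) (𝓝 y) := by
      have := e.tendsto_symm hey
      rwa [hep] at this
    have htar : e.target ∈ 𝓝 (p y) := by
      rw [← hep]; exact e.open_target.mem_nhds (e.map_source hey)
    filter_upwards [ht.eventually hgk, htar] with x hx hxt
    rw [Function.comp_apply, hx, Function.comp_apply, ← hep, e.right_inv hxt]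

end LocalHomeo

/-! ### Localization at a point -/

section Local

variable (𝔽 : Type*) [RCLike 𝔽] (n : ℕ) {M : Type*} [TopologicalSpace M]
  [ChartedSpace (EuclideanSpace ℝ (Fin n)) M] [IsManifold (𝓡 n) ∞ M] [T2Space M]

/-- The submodule `N_x(D)` of those `c` with `f c = 0` for some `f` with germ `1` at `x`. -/
def Nx (x : M) (D : Type*) [AddCommGroup D] [Module (Plus (Cc 𝔽 n M)) D] :
    Submodule (Plus (Cc 𝔽 n M)) D where
  carrier := {c | ∃ f : Cc 𝔽 n M, f.1 =ᶠ[𝓝 x] 1 ∧ ofR f • c = 0}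
  zero_mem' := by
    obtain ⟨f, hf, -⟩ := exists_bump (𝔽 := 𝔽) (n := n) (x := x) univ_mem
    exact ⟨f, hf, smul_zero _⟩
  add_mem' := by
    rintro c d ⟨f, hf, hfc⟩ ⟨g, hg, hgd⟩
    refine ⟨f * g, ?_, ?_⟩
    · filter_upwards [hf, hg] with y h1 h2
      rw [Cc.mul_apply, h1, h2]; simp
    · rw [smul_add, ofR_mul, mul_smul _ _ d, hgd, mul_comm, mul_smul _ _ c, hfc]
      simp
  smul_mem' := by
    rintro a c ⟨f, hf, hfc⟩
    exact ⟨f, hf, by rw [smul_comm, hfc, smul_zero]⟩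

/-- The localization `D_x = D / N_x(D)` of a module at `x`. -/
abbrev Stalk (x : M) (D : Type*) [AddCommGroup D] [Module (Plus (Cc 𝔽 n M)) D] : Type _ :=
  D ⧸ Nx 𝔽 n x D

/-- The class `c_x` of `c` in `D_x`. -/
abbrev toStalk (x : M) {D : Type*} [AddCommGroup D] [Module (Plus (Cc 𝔽 n M)) D] (c : D) :
    Stalk 𝔽 n x D := (Nx 𝔽 n x D).mkQ c

variable {𝔽 n}

theorem toStalk_eq_zero {x : M} {D : Type*} [AddCommGroup D] [Module (Plus (Cc 𝔽 n M)) D]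
    {c : D} : toStalk 𝔽 n x c = 0 ↔ ∃ f : Cc 𝔽 n M, f.1 =ᶠ[𝓝 x] 1 ∧ ofR f • c = 0 :=
  Submodule.Quotient.mk_eq_zero (Nx 𝔽 n x D)

theorem toStalk_smul {x : M} {D : Type*} [AddCommGroup D] [Module (Plus (Cc 𝔽 n M)) D]
    (a : Plus (Cc 𝔽 n M)) (c : D) : toStalk 𝔽 n x (a • c) = a • toStalk 𝔽 n x c := rfl

/-- The action of functions on `D_x` depends only on their germs at `x`. -/
theorem smul_toStalk_zero {x : M} {D : Type*} [AddCommGroup D] [Module (Plus (Cc 𝔽 n M)) D]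
    {f : Cc 𝔽 n M} (hf : f.1 =ᶠ[𝓝 x] 0) (s : Stalk 𝔽 n x D) : ofR f • s = 0 := by
  obtain ⟨c, rfl⟩ := Submodule.mkQ_surjective _ s
  rw [← map_smul]
  refine toStalk_eq_zero.2 ?_
  obtain ⟨p, hp1, hp2⟩ := exists_bump (𝔽 := 𝔽) (n := n) hf
  refine ⟨p, hp1, ?_⟩
  rw [← mul_smul, ← ofR_mul]
  have : p * f = 0 := by
    ext y
    change p.1 y * f.1 y = 0
    by_cases hy : y ∈ tsupport p.1
    · rw [show f.1 y = 0 from hp2 hy, mul_zero]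
    · rw [image_eq_zero_of_notMem_tsupport hy, zero_mul]
  rw [this]
  exact zero_smul (Plus (Cc 𝔽 n M)) c

theorem smul_toStalk_one {x : M} {D : Type*} [AddCommGroup D] [Module (Plus (Cc 𝔽 n M)) D]
    {f : Cc 𝔽 n M} (hf : f.1 =ᶠ[𝓝 x] 1) (s : Stalk 𝔽 n x D) : ofR f • s = s := by
  obtain ⟨c, rfl⟩ := Submodule.mkQ_surjective _ s
  rw [← map_smul, ← sub_eq_zero, ← map_sub]
  refine toStalk_eq_zero.2 ?_
  obtain ⟨p, hp1, hp2⟩ := exists_bump (𝔽 := 𝔽) (n := n) hf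
  refine ⟨p, hp1, ?_⟩
  rw [smul_sub, ← mul_smul, ← ofR_mul]
  have : p * f = p := by
    ext y
    change p.1 y * f.1 y = p.1 y
    by_cases hy : y ∈ tsupport p.1
    · rw [show f.1 y = 1 from hp2 hy, mul_one]
    · rw [image_eq_zero_of_notMem_tsupport hy, zero_mul]
  rw [this, sub_self]

/-- Germs of functions at `x` as a module over the smooth functions with compact support. -/
instance germModule (x : M) : NUModule (Cc 𝔽 n M) (Germ (𝓝 x) 𝔽) where
  smul f g := (f.1 : Germ (𝓝 x) 𝔽) * g
  smul_add' _ _ _ := mul_add _ _ _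
  add_smul' f f' g := add_mul (f.1 : Germ (𝓝 x) 𝔽) (f'.1 : Germ (𝓝 x) 𝔽) g
  mul_smul' f f' g := mul_assoc (f.1 : Germ (𝓝 x) 𝔽) (f'.1 : Germ (𝓝 x) 𝔽) g

/-- The map sending a function to its germ at `x`. -/
def germAt (𝔽 : Type*) [RCLike 𝔽] (n : ℕ) {M : Type*} [TopologicalSpace M]
    [ChartedSpace (EuclideanSpace ℝ (Fin n)) M] (x : M) :
    Cc 𝔽 n M →ₗ[Plus (Cc 𝔽 n M)] Germ (𝓝 x) 𝔽 where
  toFun f := (f.1 : Germ (𝓝 x) 𝔽)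
  map_add' _ _ := rfl
  map_smul' a f := by
    simp only [RingHom.id_apply, plus_smul_def]
    let φ : Cc 𝔽 n M →+ Germ (𝓝 x) 𝔽 :=
      { toFun := fun f => (f.1 : Germ (𝓝 x) 𝔽), map_zero' := rfl, map_add' := fun _ _ => rfl }
    change φ _ = _
    rw [map_add, map_zsmul]
    rfl

variable (𝔽 n) (C : Type*) [AddCommGroup C] [NUModule (Cc 𝔽 n M) C] [Coalg (Cc 𝔽 n M) C]

/-- The projection `C ⊗ C → C_x ⊗ C_x`. -/
def tensorToStalk (x : M) : C ⊗[Plus (Cc 𝔽 n M)] C →ₗ[Plus (Cc 𝔽 n M)]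
    Stalk 𝔽 n x C ⊗[Plus (Cc 𝔽 n M)] Stalk 𝔽 n x C :=
  TensorProduct.map (Nx 𝔽 n x C).mkQ (Nx 𝔽 n x C).mkQ

theorem smul_tensorStalk_one {x : M} {f : Cc 𝔽 n M} (hf : f.1 =ᶠ[𝓝 x] 1)
    (t : Stalk 𝔽 n x C ⊗[Plus (Cc 𝔽 n M)] Stalk 𝔽 n x C) : ofR f • t = t := by
  induction t with
  | zero => simp
  | tmul a b => rw [TensorProduct.smul_tmul', smul_toStalk_one hf]
  | add a b ha hb => rw [smul_add, ha, hb]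

/-- The comultiplication of the local coalgebra `C_x`, induced by that of `C`.  As `Cc 𝔽 n M` acts
on `C_x` through its quotient ring of germs at `x`, the tensor products of `C_x` with itself over
these two rings are the same. -/
def comulAt (x : M) : Stalk 𝔽 n x C →ₗ[Plus (Cc 𝔽 n M)]
    Stalk 𝔽 n x C ⊗[Plus (Cc 𝔽 n M)] Stalk 𝔽 n x C :=
  (Nx 𝔽 n x C).liftQ (tensorToStalk 𝔽 n C x ∘ₗ Coalg.comul) (by
    rintro c ⟨f, hf, hfc⟩
    rw [LinearMap.mem_ker, ← smul_tensorStalk_one 𝔽 n C hf ((tensorToStalk 𝔽 n C x ∘ₗ Coalg.comul) c),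
      ← map_smul, hfc, map_zero])

/-- The counit of the local coalgebra `C_x`, induced by that of `C`, with values in germs. -/
def counitAt (x : M) : Stalk 𝔽 n x C →ₗ[Plus (Cc 𝔽 n M)] Germ (𝓝 x) 𝔽 :=
  (Nx 𝔽 n x C).liftQ (germAt 𝔽 n x ∘ₗ Coalg.counit) (by
    rintro c ⟨f, hf, hfc⟩
    rw [LinearMap.mem_ker]
    have h : (germAt 𝔽 n x ∘ₗ Coalg.counit) (ofR f • c) = 0 := by rw [hfc, map_zero]
    rw [map_smul, ofR_smul] at h
    have h1 : (f.1 : Germ (𝓝 x) 𝔽) = 1 := Germ.coe_eq.2 hf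
    change (f.1 : Germ (𝓝 x) 𝔽) * _ = 0 at h
    rwa [h1, one_mul] at h)

/-- The grouplike elements of the local coalgebra `C_x`. -/
def grouplike (x : M) : Set (Stalk 𝔽 n x C) :=
  {ζ | comulAt 𝔽 n C x ζ = ζ ⊗ₜ[Plus (Cc 𝔽 n M)] ζ ∧ counitAt 𝔽 n C x ζ = 1}

variable {C}

/-- The element `c` is normalized at `x` if the germ of its counit at `x` is `1`. -/
def NormalizedAt (c : C) (x : M) : Prop := (Coalg.counit (R := Cc 𝔽 n M) c).1 =ᶠ[𝓝 x] 1

/-- The element `c` is normalized on `W` if it is normalized at each point of `W`. -/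
def NormalizedOn (c : C) (W : Set M) : Prop := ∀ x ∈ W, NormalizedAt 𝔽 n c x

variable {𝔽 n}

theorem NormalizedAt.eventually {c : C} {x : M} (h : NormalizedAt 𝔽 n c x) :
    ∀ᶠ y in 𝓝 x, NormalizedAt 𝔽 n c y := eventually_eventually_nhds.2 h

theorem toStalk_mem_grouplike {c : C} (hc : c ∈ weaklyGrouplike (Cc 𝔽 n M) C) {x : M}
    (hx : NormalizedAt 𝔽 n c x) : toStalk 𝔽 n x c ∈ grouplike 𝔽 n C x := by
  obtain ⟨c', hc'⟩ := hc
  have h1 : c = (Coalg.counit (R := Cc 𝔽 n M) c) • c' := by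
    conv_lhs => rw [← Coalg.counit_comul (R := Cc 𝔽 n M) c, hc', TensorProduct.lift.tmul]
    rfl
  have h2 : toStalk 𝔽 n x c = toStalk 𝔽 n x c' := by
    conv_lhs => rw [h1, ← ofR_smul, toStalk_smul, smul_toStalk_one hx]
  refine ⟨?_, Germ.coe_eq.2 hx⟩
  change tensorToStalk 𝔽 n C x (Coalg.comul c) = _
  rw [hc']
  change toStalk 𝔽 n x c ⊗ₜ[Plus (Cc 𝔽 n M)] toStalk 𝔽 n x c' = _
  rw [h2]

theorem toStalk_eq_eventually {c d : C} {x : M} (h : toStalk 𝔽 n x c = toStalk 𝔽 n x d) :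
    ∀ᶠ y in 𝓝 x, toStalk 𝔽 n y c = toStalk 𝔽 n y d := by
  rw [← sub_eq_zero, ← map_sub] at h
  obtain ⟨f, hf, hfc⟩ := toStalk_eq_zero.1 h
  filter_upwards [eventually_eventually_nhds.2 hf] with y hy
  rw [← sub_eq_zero, ← map_sub]
  exact toStalk_eq_zero.2 ⟨f, hy, hfc⟩

theorem tensorToStalk_eq_zero {x : M} {t : C ⊗[Plus (Cc 𝔽 n M)] C}
    (h : tensorToStalk 𝔽 n C x t = 0) : toStalk 𝔽 n x t = 0 := by
  have hl : ∀ c ∈ Nx 𝔽 n x C, ∀ d : C, toStalk 𝔽 n x (c ⊗ₜ[Plus (Cc 𝔽 n M)] d) = 0 := by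
    rintro c ⟨f, hf, hfc⟩ d
    exact toStalk_eq_zero.2 ⟨f, hf, by rw [TensorProduct.smul_tmul', hfc, TensorProduct.zero_tmul]⟩
  have hr : ∀ d ∈ Nx 𝔽 n x C, ∀ c : C, toStalk 𝔽 n x (c ⊗ₜ[Plus (Cc 𝔽 n M)] d) = 0 := by
    rintro d ⟨f, hf, hfd⟩ c
    exact toStalk_eq_zero.2 ⟨f, hf, by rw [← TensorProduct.tmul_smul, hfd, TensorProduct.tmul_zero]⟩
  let B : C →ₗ[Plus (Cc 𝔽 n M)] C →ₗ[Plus (Cc 𝔽 n M)] Stalk 𝔽 n x (C ⊗[Plus (Cc 𝔽 n M)] C) :=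
    (TensorProduct.mk (Plus (Cc 𝔽 n M)) C C).compr₂ (Nx 𝔽 n x _).mkQ
  let B' : C →ₗ[Plus (Cc 𝔽 n M)] Stalk 𝔽 n x C →ₗ[Plus (Cc 𝔽 n M)]
      Stalk 𝔽 n x (C ⊗[Plus (Cc 𝔽 n M)] C) :=
    { toFun := fun c => (Nx 𝔽 n x C).liftQ (B c) (fun d hd => hr d hd c)
      map_add' := fun c d => by
        refine LinearMap.ext fun s => ?_
        obtain ⟨e, rfl⟩ := Submodule.mkQ_surjective _ s
        change B (c + d) e = B c e + B d e
        rw [map_add, LinearMap.add_apply]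
      map_smul' := fun a c => by
        refine LinearMap.ext fun s => ?_
        obtain ⟨e, rfl⟩ := Submodule.mkQ_surjective _ s
        change B (a • c) e = a • B c e
        rw [map_smul, LinearMap.smul_apply] }
  let B'' := (Nx 𝔽 n x C).liftQ B' (fun c hc => by
    rw [LinearMap.mem_ker]
    refine LinearMap.ext fun s => ?_
    obtain ⟨e, rfl⟩ := Submodule.mkQ_surjective _ s
    exact hl c hc e)
  have key : TensorProduct.lift B'' ∘ₗ tensorToStalk 𝔽 n C x = (Nx 𝔽 n x _).mkQ :=
    TensorProduct.ext' fun c d => rfl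
  change (Nx 𝔽 n x _).mkQ t = 0
  rw [← key, LinearMap.comp_apply, h, map_zero]

theorem exists_weaklyGrouplike {x : M} {ζ : Stalk 𝔽 n x C} (hζ : ζ ∈ grouplike 𝔽 n C x) :
    ∃ c ∈ weaklyGrouplike (Cc 𝔽 n M) C, NormalizedAt 𝔽 n c x ∧ toStalk 𝔽 n x c = ζ := by
  obtain ⟨c, rfl⟩ := Submodule.mkQ_surjective _ ζ
  obtain ⟨h1, h2⟩ := hζ
  have hn : NormalizedAt 𝔽 n c x := Germ.coe_eq.1 h2
  have h3 : tensorToStalk 𝔽 n C x (Coalg.comul (R := Cc 𝔽 n M) c - c ⊗ₜ c) = 0 := by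
    rw [map_sub, sub_eq_zero]; exact h1
  obtain ⟨f, hf, hfc⟩ := toStalk_eq_zero.1 (tensorToStalk_eq_zero h3)
  rw [smul_sub, sub_eq_zero, ← map_smul, TensorProduct.smul_tmul', ofR_smul] at hfc
  refine ⟨f • c, ⟨c, hfc⟩, ?_, ?_⟩
  · rw [← ofR_smul, NormalizedAt, map_smul, ofR_smul]
    filter_upwards [hf, hn] with y h4 h5
    change f.1 y * (Coalg.counit (R := Cc 𝔽 n M) c).1 y = 1
    rw [h4, h5]; simp
  · rw [← ofR_smul]
    change (Nx 𝔽 n x C).mkQ _ = _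
    rw [map_smul]
    exact smul_toStalk_one hf _

end Local

/-! ### Smooth functions with compact support on a non-Hausdorff manifold -/

section NonHausdorff

/-- Sections, not necessarily continuous, of the sheaf of germs of functions on `E`. -/
abbrev GermSec (𝔽 : Type*) (E : Type*) [TopologicalSpace E] : Type _ :=
  ∀ y : E, Germ (𝓝 y) 𝔽

variable (𝔽 : Type*) [RCLike 𝔽] (n : ℕ) (E : Type*) [TopologicalSpace E]
  [ChartedSpace (EuclideanSpace ℝ (Fin n)) E]

variable {𝔽 n E} in
open Classical in
/-- The extension by zero of a smooth function with compact support on an open subset `U`. -/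
def extendByZero (U : TopologicalSpace.Opens E) (f : Cc 𝔽 n U) : GermSec 𝔽 E := fun y =>
  if y ∈ U then ((Function.extend Subtype.val f.1 0 : E → 𝔽) : Germ (𝓝 y) 𝔽) else 0

/-- Smooth functions with compact support on a manifold `E` which need not be Hausdorff: finite sums
of extensions by zero of smooth functions with compact support on Hausdorff open subsets. -/
def CcSec : AddSubgroup (GermSec 𝔽 E) :=
  AddSubgroup.closure {u | ∃ (U : TopologicalSpace.Opens E) (_ : T2Space U) (f : Cc 𝔽 n U),
    u = extendByZero U f}

variable {𝔽 n E}

theorem Cc.contMDiffAt_extend {U : TopologicalSpace.Opens E} (f : Cc 𝔽 n U) {y : E} (hy : y ∈ U) :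
    ContMDiffAt (𝓡 n) 𝓘(ℝ, 𝔽) ∞ (Function.extend Subtype.val f.1 0 : E → 𝔽) y := by
  rw [← contMDiffAt_subtype_iff (U := U) (x := ⟨y, hy⟩)]
  refine (f.2.1 ⟨y, hy⟩).congr_of_eventuallyEq (Eventually.of_forall fun z => ?_)
  exact Subtype.val_injective.extend_apply f.1 0 z

theorem extend_apply_of_mem {U : TopologicalSpace.Opens E} (f : U → 𝔽) {y : E} (hy : y ∈ U) :
    (Function.extend Subtype.val f 0 : E → 𝔽) y = f ⟨y, hy⟩ :=
  Subtype.val_injective.extend_apply f 0 ⟨y, hy⟩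

theorem extendByZero_add (U : TopologicalSpace.Opens E) (f g : Cc 𝔽 n U) :
    extendByZero U (f + g) = extendByZero U f + extendByZero U g := by
  funext y
  by_cases hy : y ∈ U
  · simp only [extendByZero, Pi.add_apply, if_pos hy]
    refine Germ.coe_eq.2 ?_
    filter_upwards [U.isOpen.mem_nhds hy] with z hz
    change _ = (Function.extend Subtype.val f.1 0 : E → 𝔽) z + (Function.extend Subtype.val g.1 0 : E → 𝔽) z
    rw [extend_apply_of_mem _ hz, extend_apply_of_mem _ hz, extend_apply_of_mem _ hz]
    rfl
  · simp [extendByZero, hy]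

theorem extendByZero_zero (U : TopologicalSpace.Opens E) :
    extendByZero U (0 : Cc 𝔽 n U) = 0 := by
  have h := extendByZero_add U (0 : Cc 𝔽 n U) 0
  simpa using h

/-- The germ at a point of an open subset `O`, regarded as a germ in the ambient space. -/
def pushGerm {O : TopologicalSpace.Opens E} (y : O) : Germ (𝓝 y) 𝔽 → Germ (𝓝 (y : E)) 𝔽 :=
  Germ.map' (fun g => (Function.extend Subtype.val g 0 : E → 𝔽)) (by
    intro g g' h
    rw [← O.isOpen.isOpenEmbedding_subtypeVal.map_nhds_eq y]
    refine eventually_map.2 ?_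
    filter_upwards [h] with z hz
    rw [Subtype.val_injective.extend_apply, Subtype.val_injective.extend_apply, hz])

theorem pushGerm_add {O : TopologicalSpace.Opens E} (y : O) (a b : Germ (𝓝 y) 𝔽) :
    pushGerm y (a + b) = pushGerm y a + pushGerm y b := by
  induction a using Germ.inductionOn with | _ f
  induction b using Germ.inductionOn with | _ g
  refine Germ.coe_eq.2 ?_
  filter_upwards [O.isOpen.mem_nhds y.2] with z hz
  change _ = (Function.extend Subtype.val f 0 : E → 𝔽) z + (Function.extend Subtype.val g 0 : E → 𝔽) z
  rw [extend_apply_of_mem _ hz, extend_apply_of_mem _ hz, extend_apply_of_mem _ hz]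

theorem pushGerm_zero {O : TopologicalSpace.Opens E} (y : O) :
    pushGerm y (0 : Germ (𝓝 y) 𝔽) = 0 := by
  have h := pushGerm_add y (0 : Germ (𝓝 y) 𝔽) 0
  simpa using h

open Classical in
/-- Extension by zero of sections over an open subset `O`. -/
def extendSec (O : TopologicalSpace.Opens E) : GermSec 𝔽 O →+ GermSec 𝔽 E where
  toFun u z := if h : z ∈ O then pushGerm ⟨z, h⟩ (u ⟨z, h⟩) else 0
  map_zero' := by
    funext z
    by_cases h : z ∈ O
    · simp only [dif_pos h]; exact pushGerm_zero _
    · simp [h]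
  map_add' u v := by
    funext z
    by_cases h : z ∈ O
    · simp only [dif_pos h, Pi.add_apply]; exact pushGerm_add _ _ _
    · simp [h]

open Classical in
theorem extendSec_apply (O : TopologicalSpace.Opens E) (u : GermSec 𝔽 O) (z : E) :
    extendSec O u z = if h : z ∈ O then pushGerm ⟨z, h⟩ (u ⟨z, h⟩) else 0 := rfl

theorem extendSec_mem (O : TopologicalSpace.Opens E) {u : GermSec 𝔽 O} (hu : u ∈ CcSec 𝔽 n O) :
    extendSec O u ∈ CcSec 𝔽 n E := by
  suffices h : CcSec 𝔽 n O ≤ (CcSec 𝔽 n E).comap (extendSec O) from h hu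
  refine (AddSubgroup.closure_le _).2 ?_
  rintro _ ⟨U, hU, f, rfl⟩
  refine AddSubgroup.subset_closure ?_
  let G : O → 𝔽 := Function.extend Subtype.val f.1 0
  let F : E → 𝔽 := Function.extend Subtype.val G 0
  let U' : TopologicalSpace.Opens E := ⟨Subtype.val '' (U : Set O),
    O.isOpen.isOpenMap_subtype_val _ U.isOpen⟩
  have hF : ∀ (z : E) (h : z ∈ O) (h' : (⟨z, h⟩ : O) ∈ U), F z = f.1 ⟨⟨z, h⟩, h'⟩ := by
    intro z h h'
    rw [← extend_apply_of_mem f.1 h']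
    exact extend_apply_of_mem _ h
  have hmem : ∀ z : U', ∃ h : z.1 ∈ O, (⟨z.1, h⟩ : O) ∈ U := by
    rintro ⟨_, w, hw, rfl⟩
    exact ⟨w.2, hw⟩
  let j : U → U' := fun w => ⟨w.1.1, w.1, w.2, rfl⟩
  have hj : Continuous j := (continuous_subtype_val.comp continuous_subtype_val).subtype_mk _
  let i : U' → U := fun z => ⟨⟨z.1, (hmem z).1⟩, (hmem z).2⟩
  have hi : Continuous i := (continuous_subtype_val.subtype_mk _).subtype_mk _
  have hii : Function.Injective i := by
    intro a b hab
    exact Subtype.ext (congrArg (fun w : U => w.1.1) hab)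
  have hT : T2Space U' := T2Space.of_injective_continuous hii hi
  have hFi : ∀ z : U', F z.1 = f.1 (i z) := fun z => hF z.1 (hmem z).1 (hmem z).2
  let f' : Cc 𝔽 n U' := ⟨fun z => F z.1, by
    intro z
    rw [contMDiffAt_subtype_iff, ← contMDiffAt_subtype_iff (U := O) (x := ⟨z.1, (hmem z).1⟩)]
    refine (Cc.contMDiffAt_extend f (hmem z).2).congr_of_eventuallyEq
      (Eventually.of_forall fun w => ?_)
    exact Subtype.val_injective.extend_apply G 0 w, by
    refine HasCompactSupport.intro (f.2.2.image hj) ?_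
    intro z hz
    rw [hFi]
    by_contra hne
    exact hz ⟨i z, subset_tsupport _ hne, rfl⟩⟩
  refine ⟨U', hT, f', ?_⟩
  funext z
  by_cases hz : z ∈ U'
  · obtain ⟨h, h'⟩ := hmem ⟨z, hz⟩
    rw [extendSec_apply]
    simp only [extendByZero, dif_pos h, if_pos h', if_pos hz]
    change ((F : E → 𝔽) : Germ (𝓝 z) 𝔽) = _
    refine Germ.coe_eq.2 ?_
    filter_upwards [U'.isOpen.mem_nhds hz] with w hw
    exact (extend_apply_of_mem f'.1 hw).symm
  · rw [extendSec_apply]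
    by_cases h : z ∈ O
    · have h' : (⟨z, h⟩ : O) ∉ U := fun h' => hz ⟨⟨z, h⟩, h', rfl⟩
      simp only [extendByZero, dif_pos h, if_neg h', if_neg hz]
      exact pushGerm_zero _
    · simp [extendByZero, hz, h]

/-- The map `inc₊` induced by the inclusion of an open subset: extension by zero. -/
def incPlus (𝔽 : Type*) [RCLike 𝔽] (n : ℕ) {E : Type*} [TopologicalSpace E]
    [ChartedSpace (EuclideanSpace ℝ (Fin n)) E] (O : TopologicalSpace.Opens E) :
    CcSec 𝔽 n O →+ CcSec 𝔽 n E where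
  toFun u := ⟨extendSec O u.1, extendSec_mem O u.2⟩
  map_zero' := Subtype.ext (map_zero (extendSec O))
  map_add' u v := Subtype.ext (map_add (extendSec O) u.1 v.1)

end NonHausdorff

/-! ### The spectral sheaf -/

section Spectral

variable (𝔽 : Type*) [RCLike 𝔽] (n : ℕ) (M : Type*) [TopologicalSpace M]
  [ChartedSpace (EuclideanSpace ℝ (Fin n)) M] [IsManifold (𝓡 n) ∞ M] [T2Space M]
  (C : Type*) [AddCommGroup C] [NUModule (Cc 𝔽 n M) C] [Coalg (Cc 𝔽 n M) C]

/-- The total space of the spectral sheaf: the stalk at `x` is the set of grouplike elements of the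
local coalgebra `C_x`. -/
@[ext] structure Esp where
  /-- The projection to `M`. -/
  pt : M
  val : Stalk 𝔽 n pt C
  mem : val ∈ grouplike 𝔽 n C pt

variable {𝔽 n M C}

/-- The set `c_W` of all `c_x`, `x ∈ W`. -/
def basicSet (c : C) (W : Set M) : Set (Esp 𝔽 n M C) :=
  {ζ | ζ.pt ∈ W ∧ toStalk 𝔽 n ζ.pt c = ζ.val}

variable (𝔽 n M C) in
/-- The sets `c_W`, for `W` open and `c` weakly grouplike and normalized on `W`. -/
def basicSets : Set (Set (Esp 𝔽 n M C)) :=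
  {S | ∃ c ∈ weaklyGrouplike (Cc 𝔽 n M) C, ∃ W : Set M, IsOpen W ∧ NormalizedOn 𝔽 n c W ∧
    S = basicSet c W}

/-- The topology of the spectral sheaf. -/
instance : TopologicalSpace (Esp 𝔽 n M C) := TopologicalSpace.generateFrom (basicSets 𝔽 n M C)

theorem isOpen_basicSet {c : C} (hc : c ∈ weaklyGrouplike (Cc 𝔽 n M) C) {W : Set M}
    (hW : IsOpen W) (h : NormalizedOn 𝔽 n c W) :
    IsOpen (basicSet c W : Set (Esp 𝔽 n M C)) :=
  TopologicalSpace.isOpen_generateFrom_of_mem ⟨c, hc, W, hW, h, rfl⟩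

/-- Every point of the spectral sheaf has basic neighbourhoods. -/
theorem exists_basicSet (ζ : Esp 𝔽 n M C) {V : Set M} (hV : V ∈ 𝓝 ζ.pt) :
    ∃ c ∈ weaklyGrouplike (Cc 𝔽 n M) C, ∃ W : Set M, IsOpen W ∧ NormalizedOn 𝔽 n c W ∧ W ⊆ V ∧
      ζ ∈ basicSet c W := by
  obtain ⟨c, hc, hn, hcζ⟩ := exists_weaklyGrouplike ζ.mem
  obtain ⟨W, hW, hWo, hxW⟩ := mem_nhds_iff.1 (inter_mem hV hn.eventually)
  exact ⟨c, hc, W, hWo, fun y hy => (hW hy).2, fun y hy => (hW hy).1, hxW, hcζ⟩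

theorem isTopologicalBasis_basicSets :
    TopologicalSpace.IsTopologicalBasis (basicSets 𝔽 n M C) where
  exists_subset_inter := by
    rintro _ ⟨c, hc, W, hW, hcW, rfl⟩ _ ⟨d, hd, V, hV, hdV, rfl⟩ ζ ⟨⟨h1, h2⟩, ⟨h3, h4⟩⟩
    obtain ⟨Z, hZ, hZo, hxZ⟩ := mem_nhds_iff.1
      (inter_mem (inter_mem (hW.mem_nhds h1) (hV.mem_nhds h3))
        (toStalk_eq_eventually (h2.trans h4.symm)))
    refine ⟨basicSet c Z, ⟨c, hc, Z, hZo, fun y hy => hcW y (hZ hy).1.1, rfl⟩, ⟨hxZ, h2⟩, ?_⟩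
    rintro ξ ⟨h5, h6⟩
    exact ⟨⟨(hZ h5).1.1, h6⟩, (hZ h5).1.2, ((hZ h5).2 : toStalk 𝔽 n ξ.pt c = _) ▸ h6⟩
  sUnion_eq := by
    refine Set.eq_univ_of_forall fun ζ => ?_
    obtain ⟨c, hc, W, hW, hcW, -, hζ⟩ := exists_basicSet ζ univ_mem
    exact ⟨_, ⟨c, hc, W, hW, hcW, rfl⟩, hζ⟩
  eq_generateFrom := rfl

theorem continuous_pt : Continuous (Esp.pt : Esp 𝔽 n M C → M) := by
  refine continuous_iff_continuousAt.2 fun ζ => tendsto_def.2 fun V hV => ?_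
  obtain ⟨c, hc, W, hW, hcW, hWV, hζ⟩ := exists_basicSet ζ hV
  exact mem_of_superset ((isOpen_basicSet hc hW hcW).mem_nhds hζ) fun ξ hξ => hWV hξ.1

/-- The section `x ↦ c_x` over `W`. -/
def basicSection {c : C} (hc : c ∈ weaklyGrouplike (Cc 𝔽 n M) C) {W : Set M}
    (h : NormalizedOn 𝔽 n c W) (x : W) : Esp 𝔽 n M C :=
  ⟨x.1, toStalk 𝔽 n x.1 c, toStalk_mem_grouplike hc (h x.1 x.2)⟩

theorem basicSection_of_mem {c : C} (hc : c ∈ weaklyGrouplike (Cc 𝔽 n M) C) {W : Set M}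
    (h : NormalizedOn 𝔽 n c W) {ζ : Esp 𝔽 n M C} (hζ : ζ ∈ basicSet c W) :
    basicSection hc h ⟨ζ.pt, hζ.1⟩ = ζ := by
  exact Esp.ext rfl (heq_of_eq hζ.2)

theorem continuous_basicSection {c : C} (hc : c ∈ weaklyGrouplike (Cc 𝔽 n M) C) {W : Set M}
    (h : NormalizedOn 𝔽 n c W) : Continuous (basicSection hc h) := by
  refine continuous_generateFrom_iff.2 ?_
  rintro _ ⟨d, hd, V, hV, hdV, rfl⟩
  refine isOpen_iff_mem_nhds.2 ?_
  rintro x ⟨h1, h2⟩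
  have h3 := inter_mem (hV.mem_nhds h1) (toStalk_eq_eventually h2)
  filter_upwards [continuous_subtype_val.continuousAt h3] with y hy
  exact ⟨hy.1, hy.2⟩

theorem isOpenMap_pt : IsOpenMap (Esp.pt : Esp 𝔽 n M C → M) := by
  refine isTopologicalBasis_basicSets.isOpenMap_iff.2 ?_
  rintro _ ⟨c, hc, W, hW, hcW, rfl⟩
  convert hW using 1
  ext x
  constructor
  · rintro ⟨ζ, hζ, rfl⟩
    exact hζ.1
  · intro hx
    exact ⟨basicSection hc hcW ⟨x, hx⟩, ⟨hx, rfl⟩, rfl⟩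

theorem injOn_pt (c : C) (W : Set M) :
    Set.InjOn (Esp.pt : Esp 𝔽 n M C → M) (basicSet c W) := by
  rintro ⟨x, v, hv⟩ ⟨h1, h2⟩ ⟨y, w, hw⟩ ⟨h3, h4⟩ hxy
  obtain rfl : x = y := hxy
  obtain rfl : v = w := h2.symm.trans h4
  rfl

/-- The projection of the spectral sheaf is a local homeomorphism. -/
theorem isLocalHomeomorph_pt : IsLocalHomeomorph (Esp.pt : Esp 𝔽 n M C → M) := by
  refine isLocalHomeomorph_iff_isOpenEmbedding_restrict.2 fun ζ => ?_
  obtain ⟨c, hc, W, hW, hcW, -, hζ⟩ := exists_basicSet ζ univ_mem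
  have ho := isOpen_basicSet hc hW hcW
  refine ⟨basicSet c W, ho.mem_nhds hζ, .of_continuous_injective_isOpenMap
    (continuous_pt.comp continuous_subtype_val) ?_ (isOpenMap_pt.comp ho.isOpenMap_subtype_val)⟩
  intro a b hab
  exact Subtype.ext (injOn_pt c W a.2 b.2 hab)

/-- The smooth structure of the spectral sheaf: the one for which the projection is a local
diffeomorphism. -/
instance : ChartedSpace (EuclideanSpace ℝ (Fin n)) (Esp 𝔽 n M C) :=
  etaleChartedSpace n isLocalHomeomorph_pt

instance : IsManifold (𝓡 n) ∞ (Esp 𝔽 n M C) := etale_isManifold isLocalHomeomorph_pt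

end Spectral

/-! ### The counit of the adjunction -/

section Counit

variable {𝔽 : Type*} [RCLike 𝔽] {n : ℕ} {M : Type*} [TopologicalSpace M]
  [ChartedSpace (EuclideanSpace ℝ (Fin n)) M] [IsManifold (𝓡 n) ∞ M] [T2Space M]
  {C : Type*} [AddCommGroup C] [NUModule (Cc 𝔽 n M) C] [Coalg (Cc 𝔽 n M) C]

open Classical in
/-- The section `f ∘ π|_{c_W}`, extended by zero. -/
def basicFun (c : C) (W : Set M) (f : Cc 𝔽 n M) : GermSec 𝔽 (Esp 𝔽 n M C) := fun ζ =>
  if ζ ∈ basicSet c W then ((fun ξ : Esp 𝔽 n M C => f.1 ξ.pt) : Germ (𝓝 ζ) 𝔽) else 0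

/-- The section `f ∘ π|_{c_W}` is a smooth function with compact support on the spectral sheaf. -/
theorem basicFun_mem {c : C} (hc : c ∈ weaklyGrouplike (Cc 𝔽 n M) C) {W : Set M}
    (hW : IsOpen W) (hcW : NormalizedOn 𝔽 n c W) (f : Cc 𝔽 n M) (hf : tsupport f.1 ⊆ W) :
    basicFun c W f ∈ CcSec 𝔽 n (Esp 𝔽 n M C) := by
  let U : TopologicalSpace.Opens (Esp 𝔽 n M C) := ⟨basicSet c W, isOpen_basicSet hc hW hcW⟩
  have hT : T2Space U := T2Space.of_injective_continuous (f := fun ζ : U => ζ.1.pt)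
    (fun a b hab => Subtype.ext (injOn_pt c W a.2 b.2 hab))
    (continuous_pt.comp continuous_subtype_val)
  let σ : W → U := fun x => ⟨basicSection hc hcW x, x.2, rfl⟩
  have hσ : Continuous σ := (continuous_basicSection hc hcW).subtype_mk _
  let g : Cc 𝔽 n U := ⟨fun ζ => f.1 ζ.1.pt, by
    intro ζ
    rw [contMDiffAt_subtype_iff (f := fun ξ : Esp 𝔽 n M C => f.1 ξ.pt)]
    exact (etale_contMDiffAt_iff isLocalHomeomorph_pt).2 ⟨f.1, f.2.1 _, EventuallyEq.rfl⟩, by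
    have hK : IsCompact ((Subtype.val : W → M) ⁻¹' tsupport f.1) :=
      (Topology.IsInducing.subtypeVal.isCompact_preimage_iff (by simpa using hf)).2 f.2.2
    refine HasCompactSupport.intro (hK.image hσ) ?_
    intro ζ hζ
    by_contra hne
    refine hζ ⟨⟨ζ.1.pt, ζ.2.1⟩, subset_tsupport _ hne, ?_⟩
    exact Subtype.ext (basicSection_of_mem hc hcW ζ.2)⟩
  refine AddSubgroup.subset_closure ⟨U, hT, g, ?_⟩
  funext ζ
  by_cases hζ : ζ ∈ U
  · have hζ' : ζ ∈ basicSet c W := hζ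
    simp only [basicFun, extendByZero, if_pos hζ, if_pos hζ']
    refine Germ.coe_eq.2 ?_
    filter_upwards [U.isOpen.mem_nhds hζ] with ξ hξ
    exact (extend_apply_of_mem g.1 hξ).symm
  · have hζ' : ζ ∉ basicSet c W := hζ
    simp only [basicFun, extendByZero, if_neg hζ, if_neg hζ']

/-- The additive relation generated by the pairs `(f ∘ π|_{c_W}, f c)`. -/
def psiRel (𝔽 : Type*) [RCLike 𝔽] (n : ℕ) (M : Type*) [TopologicalSpace M]
    [ChartedSpace (EuclideanSpace ℝ (Fin n)) M] [IsManifold (𝓡 n) ∞ M] [T2Space M]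
    (C : Type*) [AddCommGroup C] [NUModule (Cc 𝔽 n M) C] [Coalg (Cc 𝔽 n M) C] :
    AddSubgroup (GermSec 𝔽 (Esp 𝔽 n M C) × C) :=
  AddSubgroup.closure {q | ∃ c ∈ weaklyGrouplike (Cc 𝔽 n M) C, ∃ W : Set M, IsOpen W ∧
    NormalizedOn 𝔽 n c W ∧ ∃ f : Cc 𝔽 n M, tsupport f.1 ⊆ W ∧ q = (basicFun c W f, f • c)}

theorem germ_zero_of_notMem {f : Cc 𝔽 n M} {W : Set M} (hf : tsupport f.1 ⊆ W) {x : M}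
    (hx : x ∉ W) : f.1 =ᶠ[𝓝 x] 0 :=
  notMem_tsupport_iff_eventuallyEq.1 fun h => hx (hf h)

/-- Related pairs are related locally at each point. -/
theorem psiRel_local {q : GermSec 𝔽 (Esp 𝔽 n M C) × C} (hq : q ∈ psiRel 𝔽 n M C) (x : M) :
    ∃ F : grouplike 𝔽 n C x →₀ Cc 𝔽 n M,
      toStalk 𝔽 n x q.2 = F.sum (fun ζ f => ofR f • ζ.1) ∧
      ∀ ζ : grouplike 𝔽 n C x,
        q.1 ⟨x, ζ.1, ζ.2⟩ = ((fun ξ : Esp 𝔽 n M C => (F ζ).1 ξ.pt) : Germ (𝓝 _) 𝔽) := by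
  have h0 : ∀ ζ : grouplike 𝔽 n C x, ofR (0 : Cc 𝔽 n M) • ζ.1 = 0 := fun ζ =>
    smul_toStalk_zero EventuallyEq.rfl _
  have hadd : ∀ (ζ : grouplike 𝔽 n C x) (f g : Cc 𝔽 n M),
      ofR (f + g) • ζ.1 = ofR f • ζ.1 + ofR g • ζ.1 := by
    intro ζ f g
    have h : ofR (f + g) = ofR f + ofR g := Unitization.inr_add ℤ f g
    rw [h, add_smul]
  have hneg : ∀ (ζ : grouplike 𝔽 n C x) (f : Cc 𝔽 n M), ofR (-f) • ζ.1 = -(ofR f • ζ.1) := by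
    intro ζ f
    rw [eq_neg_iff_add_eq_zero, ← hadd, neg_add_cancel, h0]
  induction hq using AddSubgroup.closure_induction with
  | mem q hq =>
    obtain ⟨c, hc, W, hW, hcW, f, hf, rfl⟩ := hq
    by_cases hx : x ∈ W
    · let ζ₀ : grouplike 𝔽 n C x := ⟨toStalk 𝔽 n x c, toStalk_mem_grouplike hc (hcW x hx)⟩
      refine ⟨Finsupp.single ζ₀ f, ?_, fun ζ => ?_⟩
      · rw [Finsupp.sum_single_index (h0 _)]
        change toStalk 𝔽 n x (f • c) = _
        rw [← ofR_smul, toStalk_smul]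
      · by_cases hζ : ζ₀ = ζ
        · subst hζ
          rw [Finsupp.single_eq_same]
          exact if_pos ⟨hx, rfl⟩
        · rw [Finsupp.single_eq_of_ne' hζ]
          exact if_neg fun h => hζ (Subtype.ext h.2)
    · refine ⟨0, ?_, fun ζ => ?_⟩
      · rw [Finsupp.sum_zero_index]
        change toStalk 𝔽 n x (f • c) = _
        rw [← ofR_smul, toStalk_smul]
        exact smul_toStalk_zero (germ_zero_of_notMem hf hx) _
      · exact if_neg fun h => hx h.1
  | zero => exact ⟨0, by rw [Finsupp.sum_zero_index]; exact map_zero _, fun ζ => rfl⟩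
  | add q r _ _ hq hr =>
    obtain ⟨F, hF1, hF2⟩ := hq
    obtain ⟨G, hG1, hG2⟩ := hr
    refine ⟨F + G, ?_, fun ζ => ?_⟩
    · rw [Finsupp.sum_add_index' h0 hadd, ← hF1, ← hG1]
      exact map_add _ _ _
    · change q.1 _ + r.1 _ = _
      rw [hF2, hG2]
      rfl
  | neg q _ hq =>
    obtain ⟨F, hF1, hF2⟩ := hq
    refine ⟨-F, ?_, fun ζ => ?_⟩
    · rw [Finsupp.sum_neg_index h0]
      simp only [hneg]
      rw [Finsupp.sum_neg, ← hF1]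
      exact map_neg _ _
    · change -q.1 _ = _
      rw [hF2]
      rfl

theorem eq_zero_of_toStalk {c : C} (h : ∀ x : M, toStalk 𝔽 n x c = 0) : c = 0 := by
  obtain ⟨r, hr⟩ := Coalg.locallyUnitary (R := Cc 𝔽 n M) ({c} : Finset C)
  have hr' : r • c = c := hr c (by simp)
  rw [← hr']
  refine Cc.induction (fun f : Cc 𝔽 n M => f • c = 0) (nu_zero_smul c)
    (fun f g hf hg => by rw [NUModule.add_smul', hf, hg, add_zero]) (fun x => ?_) r
  obtain ⟨p, hp, hpc⟩ := toStalk_eq_zero.1 (h x)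
  refine ⟨_, hp, fun f hf => ?_⟩
  have : f = f * p := by
    ext y
    change f.1 y = f.1 y * p.1 y
    by_cases hy : y ∈ tsupport f.1
    · rw [show p.1 y = 1 from hf hy, mul_one]
    · rw [image_eq_zero_of_notMem_tsupport hy, zero_mul]
  rw [ofR_smul] at hpc
  rw [this, NUModule.mul_smul', hpc, nu_smul_zero]

/-- The relation is single-valued. -/
theorem psiRel_unique {d : C} (h : ((0 : GermSec 𝔽 (Esp 𝔽 n M C)), d) ∈ psiRel 𝔽 n M C) :
    d = 0 := by
  refine eq_zero_of_toStalk (𝔽 := 𝔽) (n := n) (M := M) fun x => ?_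
  obtain ⟨F, hF1, hF2⟩ := psiRel_local h x
  change toStalk 𝔽 n x d = _ at hF1
  rw [hF1]
  refine Finset.sum_eq_zero fun ζ _ => smul_toStalk_zero ?_ _
  have h1 : (fun ξ : Esp 𝔽 n M C => (F ζ).1 ξ.pt) =ᶠ[𝓝 ⟨x, ζ.1, ζ.2⟩] fun _ => 0 :=
    Germ.coe_eq.1 (hF2 ζ).symm
  have h2 : map (Esp.pt : Esp 𝔽 n M C → M) (𝓝 ⟨x, ζ.1, ζ.2⟩) = 𝓝 x :=
    isLocalHomeomorph_pt.map_nhds_eq _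
  rw [← h2]
  exact eventually_map.2 h1

/-- The relation is defined everywhere: every smooth function with compact support on the spectral
sheaf is a sum of functions of the form `f ∘ π|_{c_W}`. -/
theorem psiRel_exists {u : GermSec 𝔽 (Esp 𝔽 n M C)} (hu : u ∈ CcSec 𝔽 n (Esp 𝔽 n M C)) :
    ∃ d : C, (u, d) ∈ psiRel 𝔽 n M C := by
  suffices h : CcSec 𝔽 n (Esp 𝔽 n M C) ≤ (psiRel 𝔽 n M C).map (AddMonoidHom.fst _ _) by
    obtain ⟨q, hq, rfl⟩ := h hu
    exact ⟨q.2, hq⟩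
  refine (AddSubgroup.closure_le _).2 ?_
  rintro _ ⟨U, hU, h, rfl⟩
  refine Cc.induction (fun h : Cc 𝔽 n U =>
    extendByZero U h ∈ (psiRel 𝔽 n M C).map (AddMonoidHom.fst _ _)) ?_ ?_ ?_ h
  · change extendByZero U 0 ∈ _
    rw [extendByZero_zero]
    exact zero_mem _
  · intro f g hf hg
    change extendByZero U (f + g) ∈ _
    rw [extendByZero_add]
    exact add_mem hf hg
  · intro y
    obtain ⟨_, ⟨c, hc, W, hW, hcW, rfl⟩, hyW, hWU⟩ :=
      isTopologicalBasis_basicSets.exists_subset_of_mem_open y.2 U.isOpen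
    have ho := isOpen_basicSet hc hW hcW
    refine ⟨Subtype.val ⁻¹' basicSet c W,
      (ho.preimage continuous_subtype_val).mem_nhds hyW, fun g hg => ?_⟩
    set G : Esp 𝔽 n M C → 𝔽 := Function.extend Subtype.val g.1 0 with hG
    have hGU : ∀ (ζ : Esp 𝔽 n M C) (h : ζ ∈ U), G ζ = g.1 ⟨ζ, h⟩ := fun ζ h =>
      extend_apply_of_mem g.1 h
    let K : Set M := (fun ζ : U => ζ.1.pt) '' tsupport g.1
    have hK : IsCompact K :=
      IsCompact.image g.2.2 (continuous_pt.comp continuous_subtype_val)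
    have hKW : K ⊆ W := by
      rintro _ ⟨ζ, hζ, rfl⟩
      exact (hg hζ).1
    classical
    let F : M → 𝔽 := fun x => if hx : x ∈ W then G (basicSection hc hcW ⟨x, hx⟩) else 0
    have hF : ∀ ζ ∈ basicSet c W, F ζ.pt = G ζ := by
      intro ζ hζ
      change (if hx : ζ.pt ∈ W then G (basicSection hc hcW ⟨ζ.pt, hx⟩) else 0) = _
      rw [dif_pos hζ.1, basicSection_of_mem hc hcW hζ]
    have hF0 : ∀ x, x ∉ K → F x = 0 := by
      intro x hx
      by_cases hxW : x ∈ W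
      · have hmem : basicSection hc hcW ⟨x, hxW⟩ ∈ basicSet c W := ⟨hxW, rfl⟩
        change F (basicSection hc hcW ⟨x, hxW⟩).pt = 0
        rw [hF _ hmem, hGU _ (hWU hmem)]
        by_contra hne
        exact hx ⟨_, subset_tsupport _ hne, rfl⟩
      · exact dif_neg hxW
    have hFs : tsupport F ⊆ K := closure_minimal (fun x hx => by
      by_contra hxK
      exact hx (hF0 x hxK)) hK.isClosed
    let f : Cc 𝔽 n M := ⟨F, by
      intro x
      by_cases hxW : x ∈ W
      · have hmem : basicSection hc hcW ⟨x, hxW⟩ ∈ basicSet c W := ⟨hxW, rfl⟩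
        obtain ⟨k, hk, hGk⟩ := (etale_contMDiffAt_iff isLocalHomeomorph_pt).1
          (Cc.contMDiffAt_extend g (hWU hmem))
        refine ContMDiffAt.congr_of_eventuallyEq hk ?_
        have h2 : map (Esp.pt : Esp 𝔽 n M C → M) (𝓝 (basicSection hc hcW ⟨x, hxW⟩)) = 𝓝 x :=
          isLocalHomeomorph_pt.map_nhds_eq _
        rw [← h2]
        refine eventually_map.2 ?_
        filter_upwards [hGk, ho.mem_nhds hmem] with ξ h3 h4
        rw [hF ξ h4]
        exact h3
      · refine (contMDiffAt_const (c := (0 : 𝔽))).congr_of_eventuallyEq ?_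
        filter_upwards [hK.isClosed.isOpen_compl.mem_nhds fun h => hxW (hKW h)] with z hz
        exact hF0 z hz, hK.of_isClosed_subset (isClosed_tsupport _) hFs⟩
    refine ⟨(basicFun c W f, f • c), AddSubgroup.subset_closure
      ⟨c, hc, W, hW, hcW, f, hFs.trans hKW, rfl⟩, ?_⟩
    change basicFun c W f = extendByZero U g
    funext ζ
    by_cases hζW : ζ ∈ basicSet c W
    · have hζU : ζ ∈ U := hWU hζW
      simp only [basicFun, extendByZero, if_pos hζU, if_pos hζW]
      refine Germ.coe_eq.2 ?_
      filter_upwards [ho.mem_nhds hζW] with ξ hξ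
      exact hF ξ hξ
    · by_cases hζU : ζ ∈ U
      · simp only [basicFun, extendByZero, if_pos hζU, if_neg hζW]
        refine (Germ.coe_eq.2 ?_ : ((0 : Esp 𝔽 n M C → 𝔽) : Germ (𝓝 ζ) 𝔽) = _)
        have h1 : g.1 =ᶠ[𝓝 ⟨ζ, hζU⟩] 0 :=
          notMem_tsupport_iff_eventuallyEq.1 fun h => hζW (hg h)
        have h2 := U.isOpen.isOpenEmbedding_subtypeVal.map_nhds_eq ⟨ζ, hζU⟩
        change _ =ᶠ[𝓝 ((⟨ζ, hζU⟩ : U) : Esp 𝔽 n M C)] _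
        rw [← h2]
        refine eventually_map.2 ?_
        filter_upwards [h1] with ξ hξ
        exact ((hGU ξ.1 ξ.2).trans hξ).symm
      · simp only [basicFun, extendByZero, if_neg hζU, if_neg hζW]

variable (𝔽 n M C)

/-- The map `Ψ_C` from the smooth functions with compact support on the spectral sheaf of `C` to
`C`, which sends a finite sum of functions `fᵢ ∘ π|_{(cᵢ)_{Wᵢ}}` to the sum of the `fᵢ cᵢ`. -/
def Psi : CcSec 𝔽 n (Esp 𝔽 n M C) →+ C where
  toFun u := (psiRel_exists u.2).choose
  map_zero' := psiRel_unique (psiRel_exists (zero_mem (CcSec 𝔽 n (Esp 𝔽 n M C)))).choose_spec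
  map_add' u v := by
    have h := sub_mem (psiRel_exists (u + v).2).choose_spec
      (add_mem (psiRel_exists u.2).choose_spec (psiRel_exists v.2).choose_spec)
    rw [Prod.mk_add_mk, Prod.mk_sub_mk] at h
    have h0 : ((u + v : CcSec 𝔽 n (Esp 𝔽 n M C)) : GermSec 𝔽 (Esp 𝔽 n M C)) - (u.1 + v.1) = 0 :=
      sub_self _
    rw [h0] at h
    exact sub_eq_zero.1 (psiRel_unique h)

variable {𝔽 n M C}

theorem Psi_basicFun {c : C} (hc : c ∈ weaklyGrouplike (Cc 𝔽 n M) C) {W : Set M}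
    (hW : IsOpen W) (hcW : NormalizedOn 𝔽 n c W) (f : Cc 𝔽 n M) (hf : tsupport f.1 ⊆ W) :
    Psi 𝔽 n M C ⟨basicFun c W f, basicFun_mem hc hW hcW f hf⟩ = f • c := by
  have h1 := (psiRel_exists (basicFun_mem hc hW hcW f hf)).choose_spec
  have h2 : (basicFun c W f, f • c) ∈ psiRel 𝔽 n M C :=
    AddSubgroup.subset_closure ⟨c, hc, W, hW, hcW, f, hf, rfl⟩
  have h := sub_mem h1 h2
  rw [Prod.mk_sub_mk, sub_self] at h
  exact sub_eq_zero.1 (psiRel_unique h)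

variable (𝔽 n M)

/-- The open subsheaf of the spectral sheaf determined by a set `Λ` of weakly grouplike elements:
its stalk at `x` consists of all `c_x` with `c ∈ Λ` normalized at `x`. -/
def EspSub (Λ : Set C) (hΛ : Λ ⊆ weaklyGrouplike (Cc 𝔽 n M) C) :
    TopologicalSpace.Opens (Esp 𝔽 n M C) where
  carrier := {ζ | ∃ c ∈ Λ, NormalizedAt 𝔽 n c ζ.pt ∧ toStalk 𝔽 n ζ.pt c = ζ.val}
  is_open' := by
    refine isOpen_iff_mem_nhds.2 ?_
    rintro ζ ⟨c, hc, hn, hcζ⟩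
    obtain ⟨W, hW, hWo, hζW⟩ := mem_nhds_iff.1 hn.eventually
    refine mem_of_superset ((isOpen_basicSet (hΛ hc) hWo fun y hy => hW hy).mem_nhds ⟨hζW, hcζ⟩) ?_
    rintro ξ ⟨h1, h2⟩
    exact ⟨c, hc, hW h1, h2⟩

/-- The restriction of `Ψ_C` to the functions on the subsheaf determined by `Λ`. -/
def PsiSub (Λ : Set C) (hΛ : Λ ⊆ weaklyGrouplike (Cc 𝔽 n M) C) :
    CcSec 𝔽 n (EspSub 𝔽 n M Λ hΛ) →+ C :=
  (Psi 𝔽 n M C).comp (incPlus 𝔽 n (EspSub 𝔽 n M Λ hΛ))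

/-- `Λ` normally generates `C`: every element of `C` is a finite sum of `fᵢ cᵢ`, where `cᵢ ∈ Λ` is
normalized on the support of `fᵢ`. -/
def NormallyGenerates (Λ : Set C) : Prop :=
  ∀ c : C, ∃ (k : ℕ) (f : Fin k → Cc 𝔽 n M) (d : Fin k → C),
    (∀ i, d i ∈ Λ) ∧ (∀ i, NormalizedOn 𝔽 n (d i) (tsupport (f i).1)) ∧ c = ∑ i, f i • d i

/-- `Λ` is normally linearly independent at `x`. -/
def NormallyLinearIndependentAt (Λ : Set C) (x : M) : Prop :=
  ∀ (k : ℕ) (d : Fin k → C) (f : Fin k → Cc 𝔽 n M),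
    (∀ i, d i ∈ Λ) → (∀ i, NormalizedAt 𝔽 n (d i) x) → ∑ i, f i • d i = 0 →
    (∀ i, (f i).1 =ᶠ[𝓝 x] 0) ∨
      ∃ i j, i ≠ j ∧ ∃ g : Cc 𝔽 n M, g.1 =ᶠ[𝓝 x] 1 ∧ g • d i = g • d j

/-- `Λ` is normally linearly independent if it is so at every point. -/
def NormallyLinearIndependent (Λ : Set C) : Prop :=
  ∀ x : M, NormallyLinearIndependentAt 𝔽 n M Λ x

end Counit

end SheafCoalg

end

/-! Over a point `x`, the map `Ψ_C` is the evaluation `u ↦ ∑ u(ζ) ζ`, a finite sum over the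
grouplike elements `ζ` of `C_x` whose coefficients are the germs of `u`.

A section supported in the sheet `c_W` has a single term over each point of `W` and none elsewhere,
so it is sent to `f c`, where `f` is the counit of its image because `c` is normalized on `W`.
Partitions of unity decompose every section into such sections, so the image of `Ψ_C^Λ` is
generated by the products `f c` with `c ∈ Λ` normalized on the support of `f`.

A relation between germs at `x` becomes, after multiplication by a bump function, a relation
between sections supported near `x`. Injectivity is therefore a pointwise condition: the germs at
`x` of the elements of `Λ` normalized there are linearly independent over the ring of germs of
functions. -/

namespace SheafCoalg

open TopologicalSpace (Opens)

section ExtensionByZero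

variable {𝔽 : Type*} [RCLike 𝔽] {n : ℕ} {E : Type*} [TopologicalSpace E]

theorem pushGerm_comp_val {O : Opens E} (y : O) (g : E → 𝔽) :
    pushGerm y ((fun z : O => g z : O → 𝔽) : Germ (𝓝 y) 𝔽) = (g : Germ (𝓝 (y : E)) 𝔽) := by
  refine Germ.coe_eq.2 ?_
  filter_upwards [O.isOpen.mem_nhds y.2] with z hz
  exact extend_apply_of_mem _ hz

theorem pushGerm_injective {O : Opens E} (y : O) :
    Function.Injective (pushGerm y : Germ (𝓝 y) 𝔽 → Germ (𝓝 (y : E)) 𝔽) := by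
  refine Function.LeftInverse.injective
    (g := fun a => a.compTendsto Subtype.val continuous_subtype_val.continuousAt) fun a => ?_
  induction a using Germ.inductionOn with | _ f
  exact congrArg _ (Function.extend_comp Subtype.val_injective f 0)

theorem extendSec_apply_of_mem {O : Opens E} (u : GermSec 𝔽 O) {y : E} (hy : y ∈ O) :
    extendSec O u y = pushGerm ⟨y, hy⟩ (u ⟨y, hy⟩) :=
  dif_pos hy

theorem extendSec_apply_of_notMem {O : Opens E} (u : GermSec 𝔽 O) {y : E} (hy : y ∉ O) :
    extendSec O u y = 0 :=
  dif_neg hy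

variable [ChartedSpace (EuclideanSpace ℝ (Fin n)) E]

theorem incPlus_injective (O : Opens E) : Function.Injective (incPlus 𝔽 n O) := by
  refine fun u v h => Subtype.ext (funext fun y => pushGerm_injective y ?_)
  have hy : extendSec O u.1 y = extendSec O v.1 y := congrFun (congrArg Subtype.val h) y
  rwa [extendSec_apply_of_mem _ y.2, extendSec_apply_of_mem _ y.2] at hy

theorem extendByZero_apply_of_mem {U : Opens E} (f : Cc 𝔽 n U) {y : E} (hy : y ∈ U) :
    extendByZero U f y = pushGerm ⟨y, hy⟩ (f.1 : Germ (𝓝 (⟨y, hy⟩ : U)) 𝔽) :=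
  if_pos hy

theorem extendByZero_apply_of_notMem {U : Opens E} (f : Cc 𝔽 n U) {y : E} (hy : y ∉ U) :
    extendByZero U f y = 0 :=
  if_neg hy

theorem extendByZero_apply_of_notMem_tsupport {U : Opens E} (f : Cc 𝔽 n U) {y : E}
    (hy : y ∉ Subtype.val '' tsupport f.1) : extendByZero U f y = 0 := by
  by_cases h : y ∈ U
  · have hf : f.1 =ᶠ[𝓝 ⟨y, h⟩] 0 :=
      notMem_tsupport_iff_eventuallyEq.1 fun h' => hy ⟨_, h', rfl⟩
    rw [extendByZero_apply_of_mem f h, Germ.coe_eq.2 hf]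
    exact pushGerm_zero _
  · exact extendByZero_apply_of_notMem f h

theorem extendByZero_mem {U : Opens E} [T2Space U] (f : Cc 𝔽 n U) :
    extendByZero U f ∈ CcSec 𝔽 n E :=
  AddSubgroup.subset_closure ⟨U, ‹_›, f, rfl⟩

theorem exists_extendSec_eq_extendByZero {O U : Opens E} (hUO : U ≤ O) [T2Space U]
    (f : Cc 𝔽 n U) : ∃ v ∈ CcSec 𝔽 n O, extendSec O v = extendByZero U f := by
  let V : Opens O := ⟨Subtype.val ⁻¹' U, U.isOpen.preimage continuous_subtype_val⟩
  let i : V → U := fun z => ⟨z.1.1, z.2⟩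
  let j : U → V := fun z => ⟨⟨z.1, hUO z.2⟩, z.2⟩
  have hi : Continuous i := (continuous_subtype_val.comp continuous_subtype_val).subtype_mk _
  have hj : Continuous j := (continuous_subtype_val.subtype_mk _).subtype_mk _
  have hij : Function.LeftInverse j i := fun _ => rfl
  have : T2Space V := T2Space.of_injective_continuous hij.injective hi
  let F : E → 𝔽 := Function.extend Subtype.val f.1 0
  let g : Cc 𝔽 n V := ⟨fun z => F z.1, fun z => by
    rw [contMDiffAt_subtype_iff (f := fun w : O => F w), contMDiffAt_subtype_iff]
    exact Cc.contMDiffAt_extend f z.2, by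
    refine HasCompactSupport.intro (f.2.2.image hj) fun z hz => ?_
    exact (extend_apply_of_mem f.1 z.2).trans
      (image_eq_zero_of_notMem_tsupport fun h => hz ⟨i z, h, hij z⟩)⟩
  refine ⟨extendByZero V g, extendByZero_mem g, funext fun y => ?_⟩
  by_cases hyO : y ∈ O
  · rw [extendSec_apply_of_mem _ hyO]
    by_cases hyU : y ∈ U
    · rw [extendByZero_apply_of_mem g (show ⟨y, hyO⟩ ∈ V from hyU),
        extendByZero_apply_of_mem f hyU]
      exact (congrArg _ (pushGerm_comp_val _ fun w : O => F w)).trans (pushGerm_comp_val _ F)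
    · rw [extendByZero_apply_of_notMem f hyU, extendByZero_apply_of_notMem g fun h => hyU h]
      exact pushGerm_zero _
  · rw [extendSec_apply_of_notMem _ hyO, extendByZero_apply_of_notMem f fun h => hyO (hUO h)]

theorem CcSec.addSubgroup_eq_top_of_local [IsManifold (𝓡 n) ∞ E] {T : AddSubgroup (CcSec 𝔽 n E)}
    (hT : ∀ y : E, ∃ V ∈ 𝓝 y, ∀ u : CcSec 𝔽 n E, (∀ z ∉ V, u.1 z = 0) → u ∈ T) : T = ⊤ := by
  refine top_le_iff.1 ((AddSubgroup.closure_closure_coe_preimage (k := {u : GermSec 𝔽 E |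
    ∃ (U : Opens E) (_ : T2Space U) (f : Cc 𝔽 n U), u = extendByZero U f})).ge.trans
    ((AddSubgroup.closure_le _).2 ?_))
  rintro ⟨_, hu⟩ ⟨U, _, f, rfl⟩
  suffices h : (⟨extendByZero U f, extendByZero_mem f⟩ : CcSec 𝔽 n E) ∈ T from h
  refine Cc.induction (fun f : Cc 𝔽 n U =>
    (⟨extendByZero U f, extendByZero_mem f⟩ : CcSec 𝔽 n E) ∈ T) ?_ (fun f g hf hg => ?_)
    (fun y => ?_) f
  · simp only [extendByZero_zero]
    exact T.zero_mem
  · simp only [extendByZero_add]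
    exact T.add_mem hf hg
  · obtain ⟨V, hV, hVT⟩ := hT y
    refine ⟨Subtype.val ⁻¹' V, continuous_subtype_val.continuousAt.preimage_mem_nhds hV,
      fun f hf => hVT _ fun z hz => extendByZero_apply_of_notMem_tsupport f ?_⟩
    exact fun h => hz (Set.image_subset_iff.2 hf h)

end ExtensionByZero

section LocalHomeomorph

variable {𝔽 : Type*} [RCLike 𝔽] {n : ℕ} {M : Type*} [TopologicalSpace M]
  [ChartedSpace (EuclideanSpace ℝ (Fin n)) M] {E : Type*} [TopologicalSpace E] {p : E → M}

theorem exists_pullback_of_injOn (hp : IsLocalHomeomorph p) {U : Opens E}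
    (hU : Set.InjOn p U) (f : Cc 𝔽 n M) (hf : tsupport f.1 ⊆ p '' U) :
    let _ := etaleChartedSpace n hp
    ∃ g : Cc 𝔽 n U, ∀ y : U, g.1 y = f.1 (p y) := by
  let _ := etaleChartedSpace n hp
  have hi : Topology.IsOpenEmbedding fun y : U => p y :=
    (hp.comp U.isOpen.isOpenEmbedding_subtypeVal.isLocalHomeomorph).isOpenEmbedding_of_injective
      fun y z h => Subtype.ext (hU y.2 z.2 h)
  have hK : IsCompact ((fun y : U => p y) ⁻¹' tsupport f.1) :=
    (hi.isInducing.isCompact_preimage_iff (by rwa [Set.image_eq_range] at hf)).2 f.2.2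
  refine ⟨⟨fun y => f.1 (p y), fun y => ?_, hK.of_isClosed_subset (isClosed_tsupport _)
    (tsupport_comp_subset_preimage _ hi.continuous)⟩, fun _ => rfl⟩
  exact contMDiffAt_subtype_iff.2
    ((etale_contMDiffAt_iff hp).2 ⟨f.1, f.2.1 _, EventuallyEq.rfl⟩)

end LocalHomeomorph

section Stalk

variable {𝔽 : Type*} [RCLike 𝔽] {n : ℕ} {M : Type*} [TopologicalSpace M]
  [ChartedSpace (EuclideanSpace ℝ (Fin n)) M] {x : M}

theorem Cc.mul_eventuallyEq_right {p : Cc 𝔽 n M} (hp : p.1 =ᶠ[𝓝 x] 1) (f : Cc 𝔽 n M) :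
    (p * f).1 =ᶠ[𝓝 x] f.1 := by
  filter_upwards [hp] with y hy
  rw [Cc.mul_apply, hy, Pi.one_apply, one_mul]

theorem sum_mul_nu_smul {C : Type*} [AddCommGroup C] [NUModule (Cc 𝔽 n M) C] {ι : Type*}
    (t : Finset ι) (p : Cc 𝔽 n M) (f : ι → Cc 𝔽 n M) (d : ι → C) :
    ∑ i ∈ t, (p * f i) • d i = ofR p • ∑ i ∈ t, f i • d i := by
  simp only [Finset.smul_sum, NUModule.mul_smul', ofR_smul]

variable [IsManifold (𝓡 n) ∞ M] [T2Space M]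

section Module

variable {D : Type*} [AddCommGroup D] [Module (Plus (Cc 𝔽 n M)) D]

theorem toStalk_eq_toStalk_iff {c d : D} : toStalk 𝔽 n x c = toStalk 𝔽 n x d ↔
    ∃ f : Cc 𝔽 n M, f.1 =ᶠ[𝓝 x] 1 ∧ ofR f • c = ofR f • d := by
  rw [← sub_eq_zero, ← map_sub, toStalk_eq_zero]
  simp only [smul_sub, sub_eq_zero]

theorem exists_smul_eq_zero_of_toStalk_eq_zero {c : D} (hc : toStalk 𝔽 n x c = 0) {W : Set M}
    (hW : W ∈ 𝓝 x) :
    ∃ f : Cc 𝔽 n M, f.1 =ᶠ[𝓝 x] 1 ∧ tsupport f.1 ⊆ W ∧ ofR f • c = 0 := by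
  obtain ⟨f, hf, hfc⟩ := toStalk_eq_zero.1 hc
  obtain ⟨p, hp, hpW⟩ := exists_bump (𝔽 := 𝔽) (n := n) hW
  refine ⟨p * f, (Cc.mul_eventuallyEq_right hp f).trans hf,
    (tsupport_mul_subset_left (f := p.1) (g := f.1)).trans hpW, ?_⟩
  rw [ofR_mul, mul_smul, hfc, smul_zero]

theorem smul_toStalk_congr {f g : Cc 𝔽 n M} (h : f.1 =ᶠ[𝓝 x] g.1) (s : Stalk 𝔽 n x D) :
    ofR f • s = ofR g • s := by
  have hsub : ofR (f - g) = ofR f - ofR g := Unitization.inr_sub ℤ f g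
  rw [← sub_eq_zero, ← sub_smul, ← hsub]
  exact smul_toStalk_zero (h.mono fun y hy => sub_eq_zero.2 hy) s

/-- Linear independence of a set of elements of the localization `D_x` over the ring of germs at
`x`. The coefficients are functions on `M`, which act on `D_x` through their germs. -/
def GermIndependent (S : Set (Stalk 𝔽 n x D)) : Prop :=
  ∀ (k : ℕ) (v : Fin k → Stalk 𝔽 n x D) (f : Fin k → Cc 𝔽 n M), Function.Injective v →
    (∀ i, v i ∈ S) → ∑ i, ofR (f i) • v i = 0 → ∀ i, (f i).1 =ᶠ[𝓝 x] 0

theorem GermIndependent.eventuallyEq_zero {S : Set (Stalk 𝔽 n x D)} (hS : GermIndependent S)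
    {ι : Type*} {t : Finset ι} {v : ι → Stalk 𝔽 n x D} {f : ι → Cc 𝔽 n M} (hv : Set.InjOn v t)
    (hvS : ∀ i ∈ t, v i ∈ S) (hsum : ∑ i ∈ t, ofR (f i) • v i = 0) {i : ι} (hi : i ∈ t) :
    (f i).1 =ᶠ[𝓝 x] 0 := by
  let e := t.equivFin.symm
  have hsum' : ∑ j, ofR (f (e j)) • v (e j) = 0 := by
    rw [Equiv.sum_comp e fun i : t => ofR (f i) • v i,
      Finset.sum_coe_sort t fun i => ofR (f i) • v i, hsum]
  have h := hS _ (fun j => v (e j)) (fun j => f (e j))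
    (fun j l hjl => e.injective (Subtype.ext (hv (e j).2 (e l).2 hjl)))
    (fun j => hvS _ (e j).2) hsum' (e.symm ⟨i, hi⟩)
  rwa [Equiv.apply_symm_apply] at h

end Module

variable {C : Type*} [AddCommGroup C] [NUModule (Cc 𝔽 n M) C]

theorem toStalk_nu_smul (f : Cc 𝔽 n M) (c : C) :
    toStalk 𝔽 n x (f • c) = ofR f • toStalk 𝔽 n x c := by
  rw [← ofR_smul, toStalk_smul]

variable [Coalg (Cc 𝔽 n M) C] {c d : C}

theorem eq_of_toStalk (h : ∀ x : M, toStalk 𝔽 n x c = toStalk 𝔽 n x d) : c = d :=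
  sub_eq_zero.1 (eq_zero_of_toStalk (𝔽 := 𝔽) (n := n) (M := M) fun x =>
    (map_sub (Nx 𝔽 n x C).mkQ c d).trans (sub_eq_zero.2 (h x)))

theorem isOpen_setOf_normalizedAt (c : C) : IsOpen {x : M | NormalizedAt 𝔽 n c x} :=
  isOpen_iff_mem_nhds.2 fun _ hx => hx.eventually

theorem counit_eventuallyEq_zero (hd : toStalk 𝔽 n x d = 0) :
    (Coalg.counit (R := Cc 𝔽 n M) d).1 =ᶠ[𝓝 x] 0 := by
  have h : counitAt 𝔽 n C x (toStalk 𝔽 n x d) = 0 := by rw [hd, map_zero]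
  exact Germ.coe_eq.1 h

theorem tsupport_counit_subset {W : Set M} (hd : ∀ x ∉ W, toStalk 𝔽 n x d = 0) :
    tsupport (Coalg.counit (R := Cc 𝔽 n M) d).1 ⊆ W := fun x hx => by
  by_contra hxW
  exact notMem_tsupport_iff_eventuallyEq.2 (counit_eventuallyEq_zero (hd x hxW)) hx

theorem NormalizedAt.counit_eventuallyEq {f : Cc 𝔽 n M} (hc : NormalizedAt 𝔽 n c x)
    (hd : toStalk 𝔽 n x d = ofR f • toStalk 𝔽 n x c) :
    (Coalg.counit (R := Cc 𝔽 n M) d).1 =ᶠ[𝓝 x] f.1 := by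
  have hcx : counitAt 𝔽 n C x (toStalk 𝔽 n x c) = 1 := Germ.coe_eq.2 hc
  have hdx : counitAt 𝔽 n C x (toStalk 𝔽 n x d) = (f.1 : Germ (𝓝 x) 𝔽) * 1 := by
    rw [hd, map_smul, ofR_smul, hcx]
    rfl
  exact Germ.coe_eq.1 (hdx.trans (mul_one _))

theorem eq_counit_smul (h : ∀ x : M, toStalk 𝔽 n x d ≠ 0 →
      NormalizedAt 𝔽 n c x ∧ ∃ f : Cc 𝔽 n M, toStalk 𝔽 n x d = ofR f • toStalk 𝔽 n x c) :
    d = Coalg.counit (R := Cc 𝔽 n M) d • c := by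
  refine eq_of_toStalk (𝔽 := 𝔽) (n := n) (M := M) fun x => ?_
  rw [toStalk_nu_smul]
  by_cases hd : toStalk 𝔽 n x d = 0
  · rw [hd, smul_toStalk_zero (counit_eventuallyEq_zero hd)]
  · obtain ⟨hc, f, hf⟩ := h x hd
    rw [hf, smul_toStalk_congr (hc.counit_eventuallyEq hf)]

end Stalk

section Psi

variable {𝔽 : Type*} [RCLike 𝔽] {n : ℕ} {M : Type*} [TopologicalSpace M]
  [ChartedSpace (EuclideanSpace ℝ (Fin n)) M] [IsManifold (𝓡 n) ∞ M] [T2Space M]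
  {C : Type*} [AddCommGroup C] [NUModule (Cc 𝔽 n M) C] [Coalg (Cc 𝔽 n M) C]

theorem germ_comp_pt_eq_zero {ζ : Esp 𝔽 n M C} {f : M → 𝔽} :
    ((fun ξ : Esp 𝔽 n M C => f ξ.pt) : Germ (𝓝 ζ) 𝔽) = 0 ↔ f =ᶠ[𝓝 ζ.pt] 0 := by
  rw [← isLocalHomeomorph_pt.map_nhds_eq ζ]
  exact Germ.coe_eq (f := fun ξ : Esp 𝔽 n M C => f ξ.pt) (g := fun _ => 0)

theorem exists_toStalk_Psi_eq_sum (u : CcSec 𝔽 n (Esp 𝔽 n M C)) {x : M}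
    {S : Set (grouplike 𝔽 n C x)} (hS : ∀ ζ ∉ S, u.1 ⟨x, ζ.1, ζ.2⟩ = 0) :
    ∃ F : grouplike 𝔽 n C x →₀ Cc 𝔽 n M, ↑F.support ⊆ S ∧
      toStalk 𝔽 n x (Psi 𝔽 n M C u) = ∑ ζ ∈ F.support, ofR (F ζ) • ζ.1 ∧
      ∀ ζ, u.1 ⟨x, ζ.1, ζ.2⟩ = ((fun ξ : Esp 𝔽 n M C => (F ζ).1 ξ.pt) : Germ (𝓝 _) 𝔽) := by
  classical
  obtain ⟨F, hF, hFu⟩ := psiRel_local (psiRel_exists u.2).choose_spec x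
  refine ⟨F.filter (· ∈ S), ?_, ?_, fun ζ => ?_⟩
  · intro ζ hζ
    rw [Finsupp.support_filter] at hζ
    exact (Finset.mem_filter.1 hζ).2
  · change toStalk 𝔽 n x (Psi 𝔽 n M C u) = (F.filter (· ∈ S)).sum fun ζ f => ofR f • ζ.1
    rw [Finsupp.sum_filter_index, Finsupp.support_filter]
    refine hF.trans (Finset.sum_filter_of_ne fun ζ _ hne => ?_).symm
    by_contra hζ
    exact hne (smul_toStalk_zero (germ_comp_pt_eq_zero.1 ((hFu ζ).symm.trans (hS ζ hζ))) _)
  · by_cases hζ : ζ ∈ S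
    · rw [Finsupp.filter_apply_pos _ _ hζ]
      exact hFu ζ
    · rw [Finsupp.filter_apply_neg _ _ hζ]
      exact hS ζ hζ

theorem toStalk_Psi_eq_zero {u : CcSec 𝔽 n (Esp 𝔽 n M C)} {x : M}
    (hu : ∀ ζ : grouplike 𝔽 n C x, u.1 ⟨x, ζ.1, ζ.2⟩ = 0) :
    toStalk 𝔽 n x (Psi 𝔽 n M C u) = 0 := by
  obtain ⟨F, hF, hΨ, -⟩ := exists_toStalk_Psi_eq_sum u (S := ∅) fun ζ _ => hu ζ
  exact hΨ.trans (Finset.sum_eq_zero fun ζ hζ => (hF hζ).elim)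

theorem exists_toStalk_Psi_eq_smul {u : CcSec 𝔽 n (Esp 𝔽 n M C)} {x : M}
    (ζ₀ : grouplike 𝔽 n C x) (hu : ∀ ζ ≠ ζ₀, u.1 ⟨x, ζ.1, ζ.2⟩ = 0) :
    ∃ f : Cc 𝔽 n M, toStalk 𝔽 n x (Psi 𝔽 n M C u) = ofR f • ζ₀.1 := by
  obtain ⟨F, hF, hΨ, -⟩ := exists_toStalk_Psi_eq_sum u (S := {ζ₀}) hu
  refine ⟨F ζ₀, hΨ.trans (Finset.sum_eq_single ζ₀ (fun ζ hζ hne => absurd (hF hζ) hne) fun h => ?_)⟩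
  rw [Finsupp.notMem_support_iff.1 h]
  exact smul_toStalk_zero EventuallyEq.rfl _

theorem exists_Psi_eq_smul {c : C} (hc : c ∈ weaklyGrouplike (Cc 𝔽 n M) C) {W : Set M}
    (hcW : NormalizedOn 𝔽 n c W) {u : CcSec 𝔽 n (Esp 𝔽 n M C)}
    (hu : ∀ ζ ∉ basicSet c W, u.1 ζ = 0) :
    ∃ f : Cc 𝔽 n M, tsupport f.1 ⊆ W ∧ Psi 𝔽 n M C u = f • c := by
  have hout : ∀ x ∉ W, toStalk 𝔽 n x (Psi 𝔽 n M C u) = 0 := fun x hx =>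
    toStalk_Psi_eq_zero fun ζ => hu _ fun h => hx h.1
  refine ⟨_, tsupport_counit_subset hout, eq_counit_smul fun x hx => ?_⟩
  have hxW : x ∈ W := by_contra fun h => hx (hout x h)
  exact ⟨hcW x hxW, exists_toStalk_Psi_eq_smul ⟨_, toStalk_mem_grouplike hc (hcW x hxW)⟩
    fun ζ hne => hu _ fun h => hne (Subtype.ext h.2.symm)⟩

theorem exists_basicFun_eq_extendByZero {c : C} (hc : c ∈ weaklyGrouplike (Cc 𝔽 n M) C)
    {W : Set M} (hW : IsOpen W) (hcW : NormalizedOn 𝔽 n c W) (f : Cc 𝔽 n M)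
    (hf : tsupport f.1 ⊆ W) :
    ∃ (U : Opens (Esp 𝔽 n M C)) (_ : T2Space U) (g : Cc 𝔽 n U), U.1 = basicSet c W ∧
      basicFun c W f = extendByZero U g := by
  let U : Opens (Esp 𝔽 n M C) := ⟨basicSet c W, isOpen_basicSet hc hW hcW⟩
  have hU : Set.InjOn Esp.pt (U : Set (Esp 𝔽 n M C)) := injOn_pt c W
  have : T2Space U := T2Space.of_injective_continuous (f := fun ζ : U => ζ.1.pt)
    (fun ζ ξ h => Subtype.ext (hU ζ.2 ξ.2 h)) (continuous_pt.comp continuous_subtype_val)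
  obtain ⟨g, hg⟩ := exists_pullback_of_injOn isLocalHomeomorph_pt hU f fun x hx =>
    ⟨basicSection hc hcW ⟨x, hf hx⟩, ⟨hf hx, rfl⟩, rfl⟩
  refine ⟨U, this, g, rfl, funext fun ζ => ?_⟩
  by_cases hζ : ζ ∈ U
  · rw [extendByZero_apply_of_mem g hζ, funext hg]
    exact (if_pos hζ).trans
      (pushGerm_comp_val ⟨ζ, hζ⟩ fun ξ : Esp 𝔽 n M C => f.1 ξ.pt).symm
  · rw [extendByZero_apply_of_notMem g hζ]
    exact if_neg hζ

theorem exists_incPlus_eq_basicFun {Λ : Set C} (hΛ : Λ ⊆ weaklyGrouplike (Cc 𝔽 n M) C) {c : C}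
    (hc : c ∈ Λ) {W : Set M} (hW : IsOpen W) (hcW : NormalizedOn 𝔽 n c W) (f : Cc 𝔽 n M)
    (hf : tsupport f.1 ⊆ W) :
    ∃ v : CcSec 𝔽 n (EspSub 𝔽 n M Λ hΛ), (incPlus 𝔽 n _ v).1 = basicFun c W f ∧
      PsiSub 𝔽 n M Λ hΛ v = f • c := by
  obtain ⟨U, _, g, hU, hfg⟩ := exists_basicFun_eq_extendByZero (hΛ hc) hW hcW f hf
  have hUΛ : U ≤ EspSub 𝔽 n M Λ hΛ := fun ζ hζ => by
    have hζW : ζ ∈ basicSet c W := hU ▸ hζ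
    exact ⟨c, hc, hcW _ hζW.1, hζW.2⟩
  obtain ⟨v, hv, hvg⟩ := exists_extendSec_eq_extendByZero hUΛ g
  refine ⟨⟨v, hv⟩, hvg.trans hfg.symm, ?_⟩
  rw [← Psi_basicFun (hΛ hc) hW hcW f hf]
  exact congrArg (Psi 𝔽 n M C) (Subtype.ext (hvg.trans hfg.symm))

end Psi

section Range

variable {𝔽 : Type*} [RCLike 𝔽] {n : ℕ} {M : Type*} [TopologicalSpace M]
  [ChartedSpace (EuclideanSpace ℝ (Fin n)) M] {C : Type*} [AddCommGroup C]
  [NUModule (Cc 𝔽 n M) C] [Coalg (Cc 𝔽 n M) C] {Λ : Set C}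

variable (𝔽 n M) in
/-- The multiples `f d` with `d ∈ Λ` normalized on the support of `f`; `Λ` normally generates `C`
when they generate `C` as a group. -/
def normalMultiples (Λ : Set C) : Set C :=
  {c | ∃ (f : Cc 𝔽 n M) (d : C), d ∈ Λ ∧ NormalizedOn 𝔽 n d (tsupport f.1) ∧ c = f • d}

theorem neg_mem_normalMultiples {c : C} (hc : c ∈ normalMultiples 𝔽 n M Λ) :
    -c ∈ normalMultiples 𝔽 n M Λ := by
  obtain ⟨f, d, hd, hdf, rfl⟩ := hc
  have hsupp : tsupport (-f : Cc 𝔽 n M).1 = tsupport f.1 :=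
    congrArg closure (Function.support_neg f.1)
  refine ⟨-f, d, hd, hsupp ▸ hdf, ?_⟩
  exact (congrArg (fun φ : C →+ C => φ d) (map_neg (actHom (Cc 𝔽 n M) C) f)).symm

theorem normallyGenerates_iff :
    NormallyGenerates 𝔽 n M Λ ↔ AddSubgroup.closure (normalMultiples 𝔽 n M Λ) = ⊤ := by
  rw [AddSubgroup.eq_top_iff']
  refine forall_congr' fun c => ⟨?_, fun hc => ?_⟩
  · rintro ⟨k, f, d, hd, hdf, rfl⟩
    exact sum_mem fun i _ => AddSubgroup.subset_closure ⟨f i, d i, hd i, hdf i, rfl⟩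
  · rw [← AddSubgroup.mem_toAddSubmonoid, AddSubgroup.closure_toAddSubmonoid] at hc
    obtain ⟨l, hl, rfl⟩ := AddSubmonoid.exists_list_of_mem_closure hc
    have hl' : ∀ i : Fin l.length, l[i] ∈ normalMultiples 𝔽 n M Λ := fun i =>
      (hl _ (List.getElem_mem i.2)).elim id fun h => neg_neg l[i] ▸ neg_mem_normalMultiples h
    choose f d hd hdf hfd using hl'
    refine ⟨l.length, f, d, hd, hdf, ?_⟩
    simp only [← hfd]
    exact (Fin.sum_univ_getElem l).symm

variable [IsManifold (𝓡 n) ∞ M] [T2Space M]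

theorem PsiSub_mem_closure_normalMultiples (hΛ : Λ ⊆ weaklyGrouplike (Cc 𝔽 n M) C)
    (u : CcSec 𝔽 n (EspSub 𝔽 n M Λ hΛ)) :
    PsiSub 𝔽 n M Λ hΛ u ∈ AddSubgroup.closure (normalMultiples 𝔽 n M Λ) := by
  suffices h : (AddSubgroup.closure (normalMultiples 𝔽 n M Λ)).comap (PsiSub 𝔽 n M Λ hΛ) = ⊤ from
    (AddSubgroup.eq_top_iff' _).1 h u
  refine CcSec.addSubgroup_eq_top_of_local fun y => ?_
  obtain ⟨c, hc, hcn, hcy⟩ := y.2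
  let W : Set M := {x | NormalizedAt 𝔽 n c x}
  have hcW : NormalizedOn 𝔽 n c W := fun x hx => hx
  have hcW_open : IsOpen (basicSet c W : Set (Esp 𝔽 n M C)) :=
    isOpen_basicSet (hΛ hc) (isOpen_setOf_normalizedAt c) hcW
  refine ⟨_, (hcW_open.preimage continuous_subtype_val).mem_nhds ⟨hcn, hcy⟩, fun u hu => ?_⟩
  have hout : ∀ ζ ∉ basicSet c W, (incPlus 𝔽 n _ u).1 ζ = 0 := fun ζ hζ => by
    by_cases hζΛ : ζ ∈ EspSub 𝔽 n M Λ hΛ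
    · refine (extendSec_apply_of_mem u.1 hζΛ).trans ?_
      rw [hu ⟨ζ, hζΛ⟩ hζ, pushGerm_zero]
    · exact extendSec_apply_of_notMem _ hζΛ
  obtain ⟨f, hf, hΨ⟩ := exists_Psi_eq_smul (hΛ hc) hcW hout
  exact AddSubgroup.subset_closure ⟨f, c, hc, fun x hx => hcW x (hf hx), hΨ⟩

theorem range_PsiSub (hΛ : Λ ⊆ weaklyGrouplike (Cc 𝔽 n M) C) :
    (PsiSub 𝔽 n M Λ hΛ).range = AddSubgroup.closure (normalMultiples 𝔽 n M Λ) := by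
  refine le_antisymm ?_ ((AddSubgroup.closure_le _).2 ?_)
  · rintro _ ⟨u, rfl⟩
    exact PsiSub_mem_closure_normalMultiples hΛ u
  · rintro _ ⟨f, d, hd, hdf, rfl⟩
    obtain ⟨v, -, hv⟩ := exists_incPlus_eq_basicFun hΛ hd (isOpen_setOf_normalizedAt d)
      (fun _ hx => hx) f hdf
    exact ⟨v, hv⟩

theorem surjective_PsiSub_iff (hΛ : Λ ⊆ weaklyGrouplike (Cc 𝔽 n M) C) :
    Function.Surjective (PsiSub 𝔽 n M Λ hΛ) ↔ NormallyGenerates 𝔽 n M Λ := by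
  rw [normallyGenerates_iff, ← range_PsiSub hΛ, AddMonoidHom.range_eq_top]

end Range

section Kernel

variable {𝔽 : Type*} [RCLike 𝔽] {n : ℕ} {M : Type*} [TopologicalSpace M]
  [ChartedSpace (EuclideanSpace ℝ (Fin n)) M] [IsManifold (𝓡 n) ∞ M] [T2Space M]
  {C : Type*} [AddCommGroup C] [NUModule (Cc 𝔽 n M) C] [Coalg (Cc 𝔽 n M) C] {Λ : Set C} {x : M}

variable (𝔽 n) in
/-- The stalk of `E_sp^Λ(C)` at `x`, as a set of elements of `C_x`: the germs at `x` of the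
elements of `Λ` which are normalized at `x`. -/
def normalizedGerms (Λ : Set C) (x : M) : Set (Stalk 𝔽 n x C) :=
  {s | ∃ c ∈ Λ, NormalizedAt 𝔽 n c x ∧ toStalk 𝔽 n x c = s}

theorem GermIndependent.normallyLinearIndependentAt
    (h : GermIndependent (normalizedGerms 𝔽 n Λ x)) : NormallyLinearIndependentAt 𝔽 n M Λ x := by
  refine fun k d f hd hdn hsum => or_iff_not_imp_right.2 fun hne => ?_
  have hinj : Function.Injective fun i => toStalk 𝔽 n x (d i) := fun i j hij => by
    by_contra hij'
    obtain ⟨g, hg, hgd⟩ := toStalk_eq_toStalk_iff.1 hij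
    rw [ofR_smul, ofR_smul] at hgd
    exact hne ⟨i, j, hij', g, hg, hgd⟩
  refine h k _ f hinj (fun i => ⟨d i, hd i, hdn i, rfl⟩) ?_
  simp only [← toStalk_nu_smul, ← map_sum]
  rw [hsum, map_zero]

theorem NormallyLinearIndependentAt.germIndependent (h : NormallyLinearIndependentAt 𝔽 n M Λ x) :
    GermIndependent (normalizedGerms 𝔽 n Λ x) := by
  intro k v f hv hvΛ hsum
  choose d hd hdn hdv using hvΛ
  simp only [← hdv, ← toStalk_nu_smul, ← map_sum] at hsum
  obtain ⟨p, hp, hp0⟩ := toStalk_eq_zero.1 hsum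
  rw [← sum_mul_nu_smul] at hp0
  rcases h k d (fun i => p * f i) hd hdn hp0 with h0 | ⟨i, j, hij, g, hg, hgd⟩
  · exact fun i => (Cc.mul_eventuallyEq_right hp (f i)).symm.trans (h0 i)
  · rw [← ofR_smul, ← ofR_smul] at hgd
    refine absurd (hv ?_) hij
    rw [← hdv i, ← hdv j]
    exact toStalk_eq_toStalk_iff.2 ⟨g, hg, hgd⟩

theorem normallyLinearIndependentAt_iff :
    NormallyLinearIndependentAt 𝔽 n M Λ x ↔ GermIndependent (normalizedGerms 𝔽 n Λ x) :=
  ⟨NormallyLinearIndependentAt.germIndependent, GermIndependent.normallyLinearIndependentAt⟩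

theorem eventuallyEq_zero_of_sum_basicFun_eq_zero {ι : Type*} [Fintype ι] {d : ι → C}
    {g : ι → Cc 𝔽 n M} {W : Set M} (hxW : x ∈ W)
    (hd : ∀ i, d i ∈ weaklyGrouplike (Cc 𝔽 n M) C) (hdn : ∀ i, NormalizedAt 𝔽 n (d i) x)
    (hinj : Function.Injective fun i => toStalk 𝔽 n x (d i))
    (hsum : ∑ i, basicFun (d i) W (g i) = 0) (i : ι) : (g i).1 =ᶠ[𝓝 x] 0 := by
  let ζ : Esp 𝔽 n M C := ⟨x, toStalk 𝔽 n x (d i), toStalk_mem_grouplike (hd i) (hdn i)⟩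
  have hζ : ∑ j, basicFun (d j) W (g j) ζ = 0 := by rw [← Finset.sum_apply, hsum, Pi.zero_apply]
  have hne : ∀ j ≠ i, basicFun (d j) W (g j) ζ = 0 := fun j hji =>
    if_neg fun h => hji (hinj h.2)
  rw [Fintype.sum_eq_single i hne, basicFun, if_pos ⟨hxW, rfl⟩] at hζ
  exact germ_comp_pt_eq_zero.1 hζ

theorem germIndependent_of_injective_PsiSub {hΛ : Λ ⊆ weaklyGrouplike (Cc 𝔽 n M) C}
    (hinj : Function.Injective (PsiSub 𝔽 n M Λ hΛ)) (x : M) :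
    GermIndependent (normalizedGerms 𝔽 n Λ x) := by
  intro k v f hv hvΛ hsum
  choose d hd hdn hdv using hvΛ
  simp only [← hdv, ← toStalk_nu_smul, ← map_sum] at hsum
  let W : Set M := ⋂ i, {y | NormalizedAt 𝔽 n (d i) y}
  have hW : IsOpen W := isOpen_iInter_of_finite fun i => isOpen_setOf_normalizedAt (d i)
  have hxW : x ∈ W := Set.mem_iInter.2 hdn
  obtain ⟨p, hp, hpW, hp0⟩ := exists_smul_eq_zero_of_toStalk_eq_zero hsum (hW.mem_nhds hxW)
  choose u hu hΨu using fun i => exists_incPlus_eq_basicFun hΛ (hd i) hW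
    (fun y hy => Set.mem_iInter.1 hy i) (p * f i)
    ((tsupport_mul_subset_left (f := p.1) (g := (f i).1)).trans hpW)
  have hu0 : ∑ i, u i = 0 := by
    refine hinj ?_
    simp only [map_sum, hΨu, map_zero]
    rw [sum_mul_nu_smul, hp0]
  have hbasic : ∑ i, basicFun (d i) W (p * f i) = (0 : GermSec 𝔽 (Esp 𝔽 n M C)) := by
    simp only [← hu]
    rw [← AddSubgroup.val_finsetSum, ← map_sum, hu0, map_zero, AddSubgroup.coe_zero]
  have hinj_d : Function.Injective fun i => toStalk 𝔽 n x (d i) := by simpa only [hdv] using hv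
  exact fun i => (Cc.mul_eventuallyEq_right hp (f i)).symm.trans
    (eventuallyEq_zero_of_sum_basicFun_eq_zero hxW (fun i => hΛ (hd i)) hdn hinj_d hbasic i)

theorem injective_PsiSub_of_germIndependent (hΛ : Λ ⊆ weaklyGrouplike (Cc 𝔽 n M) C)
    (h : ∀ x : M, GermIndependent (normalizedGerms 𝔽 n Λ x)) :
    Function.Injective (PsiSub 𝔽 n M Λ hΛ) := by
  refine (injective_iff_map_eq_zero _).2 fun u hu => incPlus_injective _ ?_
  rw [map_zero]
  refine Subtype.ext (funext fun ξ => ?_)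
  let S : Set (grouplike 𝔽 n C ξ.pt) := {ζ | ζ.1 ∈ normalizedGerms 𝔽 n Λ ξ.pt}
  obtain ⟨F, hFS, hΨ, hF⟩ := exists_toStalk_Psi_eq_sum (incPlus 𝔽 n _ u) (S := S) fun ζ hζ =>
    extendSec_apply_of_notMem _ hζ
  have hsum : ∑ ζ ∈ F.support, ofR (F ζ) • ζ.1 = 0 :=
    hΨ.symm.trans ((congrArg (toStalk 𝔽 n ξ.pt) hu).trans (map_zero _))
  refine (hF ⟨ξ.val, ξ.mem⟩).trans (germ_comp_pt_eq_zero.2 ?_)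
  by_cases hξ : ⟨ξ.val, ξ.mem⟩ ∈ F.support
  · exact (h ξ.pt).eventuallyEq_zero Subtype.val_injective.injOn (fun ζ hζ => hFS hζ) hsum hξ
  · rw [Finsupp.notMem_support_iff.1 hξ]
    exact EventuallyEq.rfl

theorem injective_PsiSub_iff (hΛ : Λ ⊆ weaklyGrouplike (Cc 𝔽 n M) C) :
    Function.Injective (PsiSub 𝔽 n M Λ hΛ) ↔ NormallyLinearIndependent 𝔽 n M Λ :=
  ⟨fun h x => normallyLinearIndependentAt_iff.2 (germIndependent_of_injective_PsiSub h x),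
    fun h => injective_PsiSub_of_germIndependent hΛ fun x =>
      normallyLinearIndependentAt_iff.1 (h x)⟩

end Kernel

end SheafCoalg

theorem theorem12 (𝔽 : Type*) [RCLike 𝔽] (n : ℕ) (M : Type*) [TopologicalSpace M]
    [ChartedSpace (EuclideanSpace ℝ (Fin n)) M] [IsManifold (𝓡 n) ∞ M] [T2Space M]
    (C : Type*) [AddCommGroup C] [SheafCoalg.NUModule (SheafCoalg.Cc 𝔽 n M) C]
    [SheafCoalg.Coalg (SheafCoalg.Cc 𝔽 n M) C]
    (Λ : Set C) (hΛ : Λ ⊆ SheafCoalg.weaklyGrouplike (SheafCoalg.Cc 𝔽 n M) C) :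
    (Function.Surjective (SheafCoalg.PsiSub 𝔽 n M Λ hΛ) ↔
      SheafCoalg.NormallyGenerates 𝔽 n M Λ) ∧
    (Function.Injective (SheafCoalg.PsiSub 𝔽 n M Λ hΛ) ↔
      SheafCoalg.NormallyLinearIndependent 𝔽 n M Λ) :=
  ⟨SheafCoalg.surjective_PsiSub_iff hΛ, SheafCoalg.injective_PsiSub_iff hΛ⟩
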